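/- Let $\Gamma$ be an extended Dynkin graph with vertex set $I$, of type $\widetilde{A}_n$ ($n\ge 1$), $\widetilde{B}_n$ ($n\ge 3$), $\widetilde{C}_n$ ($n\ge 2$), $\widetilde{D}_n$ ($n\ge 4$), $\widetilde{E}_6$, $\widetilde{E}_7$, $\widetilde{E}_8$, $\widetilde{F}_4$ or $\widetilde{G}_2$, with its standard (untwisted) affine Cartan matrix $C=(c_{ij})_{i,j\in I}$, $c_{ij}=\langle\alpha_i^\vee,\alpha_j\rangle$; two distinct vertices $i,j$ are adjacent in $\Gamma$ if $c_{ij}\ne 0$. A vertex $i$ of $\Gamma$ is called extending if $\Gamma\setminus\{i\}$ is a Dynkin graph whose extended Dynkin graph is $\Gamma$, with $i$ as the added vertex. Let $\delta\in\mathbb{Z}_{>0}^I$ be the vector with $C\delta=0$ and $\delta_i=1$ at all extending vertices $i$. For an extending vertex $i$ let $\rho^{(i)}\in\mathbb{Z}^I$ be the vector with $\rho^{(i)}_j=1$ for all $j\ne i$ and $\delta\cdot\rho^{(i)}=0$. Firing a vertex $i$ replaces $v\in\mathbb{Z}^I$ by the vector with coordinates $v_j-c_{ij}v_i$ ($j\in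 I$). There is a unique automorphism $\iota$ of the graph $\Gamma$ such that, for every extending vertex $i$, the vertex $\iota(i)$ is extending and every way of firing, starting at $\rho^{(i)}$, vertices $k$ with current amplitude $v_k<-1$ for as long as there are such vertices stops after finitely many moves, and stops at $-\rho^{(\iota(i))}$. This $\iota$ is an involution (possibly trivial), and it is given as follows. (1) $\iota$ is the identity exactly for the graphs $$\widetilde{A}_{2m},\ \widetilde{B}_{4m-1},\ \widetilde{B}_{4m},\ \widetilde{D}_{4m},\ \widetilde{D}_{4m+1}\ (m\ge 1),\quad \widetilde{E}_6,\ \widetilde{E}_8,\ \widetilde{F}_4,\ \widetilde{G}_2.$$ (2) For $\widetilde{A}_{2m-1}$ ($m\ge1$), a cycle with $2m$ vertices (two vertices if $m=1$), $\iota$ sends every vertex to its antipodal vertex. (3) For $\widetilde{D}_{4m+2}$ and $\widetilde{D}_{4m+3}$ ($m\ge 1$), $\iota$ interchanges any two distinct exterior vertices (vertices with exactly one neighbour) that are adjacent to a common interior vertex, and it fixes all interior (that is, non-exterior) vertices. (4) For $\widetilde{B}_{4m+1}$, $\widetilde{B}_{4m+2}$, $\widetilde{C}_{m+1}$ ($m\ge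 1$) and $\widetilde{E}_7$, $\iota$ is the unique nontrivial automorphism of the graph $\Gamma$. -/

import Mathlib

/-- The names of the extended Dynkin graphs `Ã_n, B̃_n, C̃_n, D̃_n, Ẽ_6, Ẽ_7, Ẽ_8, F̃_4, G̃_2`;
the ranges of `n` are imposed by `AffineType.IsValid`. -/
inductive AffineType where
  | A (n : ℕ)
  | B (n : ℕ)
  | C (n : ℕ)
  | D (n : ℕ)
  | E6
  | E7
  | E8
  | F4
  | G2

namespace AffineType

/-- The usual ranges, under which each extended Dynkin graph has exactly one name. -/
def IsValid : AffineType → Prop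
  | A n => 1 ≤ n
  | B n => 3 ≤ n
  | C n => 2 ≤ n
  | D n => 4 ≤ n
  | E6 => True
  | E7 => True
  | E8 => True
  | F4 => True
  | G2 => True

/-- The number of vertices of the Dynkin graph `Γ₀`. -/
def rank : AffineType → ℕ
  | A n => n
  | B n => n
  | C n => n
  | D n => n
  | E6 => 6
  | E7 => 7
  | E8 => 8
  | F4 => 4
  | G2 => 2

/-- The vertices `0, 1, …, n` of the extended Dynkin graph. The vertex `0` is the one that is added
to the Dynkin graph `Γ₀` on the vertices `1, …, n`; these are in Bourbaki's order, except that for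
`G̃_2` the vertices form the path `0 — 1 — 2`. -/
abbrev Vertex (X : AffineType) : Type := Fin (X.rank + 1)

/-- The (untwisted) affine Cartan matrix, `c i j = ⟨α_i^∨, α_j⟩`, where `α_0 = δ - θ` with `θ` the
highest root of `Γ₀`. So if `i`, `j` are joined by a multiple bond and `α_i` is the shorter root,
then `c i j` is `-2` or `-3` and `c j i = -1`. The graphs of the infinite series are
* `Ã_n`: the cycle `0 — 1 — ⋯ — n — 0` (for `n = 1`, two vertices with `c 0 1 = c 1 0 = -2`);
* `B̃_n`: the path `1 — 2 — ⋯ — n` and the edge `0 — 2`; the root `α_n` is short;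
* `C̃_n`: the path `0 — 1 — ⋯ — n`; the roots `α_0` and `α_n` are long;
* `D̃_n`: the path `1 — 2 — ⋯ — n - 1` and the edges `0 — 2` and `n - 2 — n`. -/
def cartan : (X : AffineType) → Matrix X.Vertex X.Vertex ℤ
  | A n => Matrix.of fun i j : Fin (n + 1) =>
      (if i = j then 2 else 0) - (if i + 1 = j then 1 else 0) - (if j + 1 = i then 1 else 0)
  | B n => Matrix.of fun i j : Fin (n + 1) =>
      if i = j then 2
      else if i.val = n ∧ j.val + 1 = n then -2
      else if (i.val = 0 ∧ j.val = 2) ∨ (j.val = 0 ∧ i.val = 2) then -1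
      else if (1 ≤ i.val ∧ i.val + 1 = j.val) ∨ (1 ≤ j.val ∧ j.val + 1 = i.val) then -1
      else 0
  | C n => Matrix.of fun i j : Fin (n + 1) =>
      if i = j then 2
      else if i.val = 1 ∧ j.val = 0 then -2
      else if i.val + 1 = n ∧ j.val = n then -2
      else if i.val + 1 = j.val ∨ j.val + 1 = i.val then -1
      else 0
  | D n => Matrix.of fun i j : Fin (n + 1) =>
      if i = j then 2
      else if (i.val = 0 ∧ j.val = 2) ∨ (j.val = 0 ∧ i.val = 2) then -1
      else if (i.val + 2 = n ∧ j.val = n) ∨ (j.val + 2 = n ∧ i.val = n) then -1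
      else if (1 ≤ i.val ∧ i.val + 1 = j.val ∧ j.val + 1 ≤ n) ∨
          (1 ≤ j.val ∧ j.val + 1 = i.val ∧ i.val + 1 ≤ n) then -1
      else 0
  | E6 =>
      !![ 2,  0, -1,  0,  0,  0,  0;
          0,  2,  0, -1,  0,  0,  0;
         -1,  0,  2,  0, -1,  0,  0;
          0, -1,  0,  2, -1,  0,  0;
          0,  0, -1, -1,  2, -1,  0;
          0,  0,  0,  0, -1,  2, -1;
          0,  0,  0,  0,  0, -1,  2]
  | E7 =>
      !![ 2, -1,  0,  0,  0,  0,  0,  0;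
         -1,  2,  0, -1,  0,  0,  0,  0;
          0,  0,  2,  0, -1,  0,  0,  0;
          0, -1,  0,  2, -1,  0,  0,  0;
          0,  0, -1, -1,  2, -1,  0,  0;
          0,  0,  0,  0, -1,  2, -1,  0;
          0,  0,  0,  0,  0, -1,  2, -1;
          0,  0,  0,  0,  0,  0, -1,  2]
  | E8 =>
      !![ 2,  0,  0,  0,  0,  0,  0,  0, -1;
          0,  2,  0, -1,  0,  0,  0,  0,  0;
          0,  0,  2,  0, -1,  0,  0,  0,  0;
          0, -1,  0,  2, -1,  0,  0,  0,  0;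
          0,  0, -1, -1,  2, -1,  0,  0,  0;
          0,  0,  0,  0, -1,  2, -1,  0,  0;
          0,  0,  0,  0,  0, -1,  2, -1,  0;
          0,  0,  0,  0,  0,  0, -1,  2, -1;
         -1,  0,  0,  0,  0,  0,  0, -1,  2]
  | F4 =>
      !![ 2, -1,  0,  0,  0;
         -1,  2, -1,  0,  0;
          0, -1,  2, -1,  0;
          0,  0, -2,  2, -1;
          0,  0,  0, -1,  2]
  | G2 =>
      !![ 2, -1,  0;
         -1,  2, -1;
          0, -3,  2]

/-- The coordinates of `δ = α_0 + θ` in the simple roots: the positive vector with `C δ = 0` whose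
value at the extending vertices is `1`. -/
def delta : (X : AffineType) → X.Vertex → ℤ
  | A n => fun _ : Fin (n + 1) => 1
  | B n => fun i : Fin (n + 1) => if i.val ≤ 1 then 1 else 2
  | C n => fun i : Fin (n + 1) => if i.val = 0 ∨ i.val = n then 1 else 2
  | D n => fun i : Fin (n + 1) => if i.val ≤ 1 ∨ n ≤ i.val + 1 then 1 else 2
  | E6 => ![1, 1, 2, 2, 3, 2, 1]
  | E7 => ![1, 2, 2, 3, 4, 3, 2, 1]
  | E8 => ![1, 2, 3, 4, 6, 5, 4, 3, 2]
  | F4 => ![1, 2, 3, 4, 2]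
  | G2 => ![1, 2, 3]

/-- The graph `Γ`, without loops and multiple edges. -/
def graph (X : AffineType) : SimpleGraph X.Vertex :=
  SimpleGraph.fromRel fun i j => X.cartan i j ≠ 0

/-- The vertex `i` of `Γ` is extending: the complement of `i` is a Dynkin graph whose extended
Dynkin graph is `Γ`, with `i` as the added vertex. -/
def IsExtending (X : AffineType) (i : X.Vertex) : Prop :=
  ∃ Y : AffineType, Y.IsValid ∧ ∃ e : X.Vertex ≃ Y.Vertex,
    (∀ j k, Y.cartan (e j) (e k) = X.cartan j k) ∧ e i = 0

/-- Configurations of the numbers game. Those that occur here are integral. -/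
abbrev Config (X : AffineType) : Type := X.Vertex → ℤ

/-- Firing the vertex `i`: as `c i i = 2`, this negates the amplitude at `i`, adds `-(c i j) * v i`
at every `j` adjacent to `i`, and changes nothing elsewhere. -/
def fire (X : AffineType) (i : X.Vertex) (v : X.Config) : X.Config :=
  fun j => v j - X.cartan i j * v i

/-- One move of the strategy: firing some vertex of amplitude `< -1`. -/
def Step (X : AffineType) (v w : X.Config) : Prop :=
  ∃ i, v i < -1 ∧ w = X.fire i v

/-- No vertex has amplitude `< -1`, so that the strategy stops at `v`. -/
def IsFinal (X : AffineType) (v : X.Config) : Prop :=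
  ∀ i, -1 ≤ v i

/-- For an extending vertex `i` (where `δ i = 1`), the configuration `ρ^(i)` with amplitude `1` at
every `j ≠ i` and with `δ ⬝ ρ^(i) = 0`. -/
def rho (X : AffineType) (i : X.Vertex) : X.Config :=
  fun j => if j = i then -∑ k ∈ Finset.univ.erase i, X.delta k else 1

/-- However one fires vertices of amplitude `< -1`, starting at `ρ^(i)`, one stops after finitely
many moves, and then the configuration is `-ρ^(j)`. -/
def Obtains (X : AffineType) (i j : X.Vertex) : Prop :=
  Acc (fun w v => X.Step v w) (X.rho i) ∧
    ∀ v, Relation.ReflTransGen X.Step (X.rho i) v → X.IsFinal v → v = -X.rho j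

/-- The automorphism `σ` of `Γ` induces the map `ι` of the extending vertices, that is: `ι i` is the
extending vertex such that one obtains `-ρ^(ι i)` from `ρ^(i)` by the strategy. -/
def IsIota (X : AffineType) (σ : X.graph ≃g X.graph) : Prop :=
  ∀ i, X.IsExtending i → X.IsExtending (σ i) ∧ X.Obtains i (σ i)

/-- Exterior vertices of `Γ` are those with exactly one neighbour. -/
def IsExterior (X : AffineType) (i : X.Vertex) : Prop :=
  ∃! j, X.graph.Adj i j

end AffineType

/-! For a symmetric affine matrix the strategy is followed inside the affine Weyl group. Each
configuration reached from `ρ^(o)` is the image of `ρ^(o)` under an element `w` for which all `w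
α_j`, `j ≠ o`, lie between `0` and `δ` (`Frame`). A simple reflection at `k` makes a positive root
negative only if that root is `α_k`. So firing `k` could break the bounds only if `w α_j = α_k` or
`δ - w α_j = α_k`, which would mean `v k = 1` or `v k = -1`. The condition `v k < -1` excludes both,
so the bounds persist (`Frame.fire`).

Termination: some `ξ` with `ξ o = 0` satisfies `C ξ = N ρ^(o)` with `N > 0`. The height of `w ξ` is
bounded because of the frame, and a move at `k` raises it by `-N v_k > 0` (`Frame.acc`).

Outcome: let `H = ∑ δ`, and at a final `v` let `b_k` be the coefficient of `α_o` in `w⁻¹ α_k`.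
Comparing heights gives `(H - 1) v_k + H b_k ≥ 1` for all `k`. The average of these inequalities
with weights `δ_k` is an equality, so each of them is one. Then the numbers `v_k + b_k` are
nonnegative integers with `∑ δ_k (v_k + b_k) = 1`, so exactly one of them is nonzero, at some `i`
with `δ_i = 1`, and `v = -ρ^(i)` (`Frame.eq_neg_coweight`).

To find `i`, note that the Weyl group fixes modulo `N` every `x` with `C x ≡ 0` modulo `N`. The
coefficient of `α_o` in `w⁻¹ x ≡ x` gives `∑ x_k - (H - 1) x_i ≡ x_o`. One or two explicit vectors
`x` for `Ã`, `D̃`, `Ẽ_6` and `Ẽ_7` determine `i`, and for `Ẽ_8` there is no choice. The other types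
are foldings: `D̃_{n+1} → B̃_n`, `Ã_{2n-1} → C̃_n`, `Ẽ_6 → F̃_4`, `D̃_4 → G̃_2`. Firing a vertex
downstairs amounts to firing its whole fibre upstairs (`IsFolding.obtains`).

Finally, the extending vertices are those with `δ_i = 1`, and a graph automorphism that fixes them
all is trivial. This makes the automorphism `ι` unique (`isUniqueIota`). -/

open Matrix in
/-- Generalized Cartan matrices of affine type, with a positive null vector `δ`. -/
structure IsAffineMatrix {I : Type*} [Fintype I] (C : Matrix I I ℤ) (δ : I → ℤ) : Prop where
  diag : ∀ i, C i i = 2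
  nonpos : ∀ i j, i ≠ j → C i j ≤ 0
  pos : ∀ i, 0 < δ i
  null : C *ᵥ δ = 0
  conn : ∀ i j, Relation.ReflTransGen (fun a b => C a b ≠ 0) i j

/-! ### The quadratic form of an affine matrix. -/

namespace IsAffineMatrix

open Matrix

variable {I : Type*} [Fintype I] {C : Matrix I I ℤ} {δ : I → ℤ}

theorem null_sum (h : IsAffineMatrix C δ) (i : I) : ∑ j, C i j * δ j = 0 := by
  simpa [mulVec, dotProduct] using congrFun h.null i

/-- Maximum principle: the null space of an affine matrix is a line. -/
theorem proportional_of_null (h : IsAffineMatrix C δ) {x : I → ℤ} (hx : C *ᵥ x = 0) (i j : I) :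
    x i * δ j = x j * δ i := by
  have hx' : ∀ a, ∑ k, C a k * x k = 0 := fun a => by
    simpa [mulVec, dotProduct] using congrFun hx a
  obtain ⟨m, -, hm⟩ := Finset.exists_max_image Finset.univ (fun k => (x k : ℚ) / δ k)
    ⟨i, Finset.mem_univ i⟩
  -- The combination `x m • δ - δ m • x` is a nonnegative null vector that vanishes at `m`; its
  -- zeros spread along the edges.
  have ht : ∀ k, 0 ≤ x m * δ k - x k * δ m := fun k => by
    have := hm k (Finset.mem_univ k)
    rw [div_le_div_iff₀ (by exact_mod_cast h.pos k) (by exact_mod_cast h.pos m)] at this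
    have : x k * δ m ≤ x m * δ k := by exact_mod_cast this
    linarith
  have hC : ∀ a, ∑ k, C a k * (x m * δ k - x k * δ m) = 0 := fun a => by
    have : ∀ k, C a k * (x m * δ k - x k * δ m) = x m * (C a k * δ k) - δ m * (C a k * x k) :=
      fun k => by ring
    simp_rw [this, Finset.sum_sub_distrib, ← Finset.mul_sum, hx' a, h.null_sum a]
    simp
  have key : ∀ k, x m * δ k - x k * δ m = 0 := fun k => by
    induction h.conn m k with
    | refl => ring
    | @tail a b _ hab ih =>
      have hs := (Finset.sum_eq_zero_iff_of_nonpos (s := Finset.univ)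
        (f := fun k => C a k * (x m * δ k - x k * δ m)) fun k _ => by
          by_cases hak : a = k
          · subst hak; simp [ih]
          · exact mul_nonpos_of_nonpos_of_nonneg (h.nonpos a k hak) (ht k)).1 (hC a) b
            (Finset.mem_univ b)
      exact (mul_eq_zero.1 hs).resolve_left hab
  have h1 := key i
  have h2 := key j
  have hm0 := (h.pos m).ne'
  apply mul_left_cancel₀ hm0
  linear_combination δ i * h2 - δ j * h1

/-- On expanding the squares, the terms in `x i ^ 2` and in `x j ^ 2` sum to zero since `C δ = 0`;
only the mixed terms survive. All summands on the right are nonnegative, so the form is positive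
semidefinite. -/
theorem two_form_eq (h : IsAffineMatrix C δ) (hs : C.IsSymm) (x : I → ℤ) :
    2 * ((x ⬝ᵥ C *ᵥ x : ℤ) : ℚ) =
      ∑ i, ∑ j, -(C i j : ℚ) * ((x i : ℚ) * δ j - x j * δ i) ^ 2 / (δ i * δ j) := by
  have hδ : ∀ i, (δ i : ℚ) ≠ 0 := fun i => by exact_mod_cast (h.pos i).ne'
  have hn : ∀ i, ∑ j, (C i j : ℚ) * δ j = 0 := fun i => by exact_mod_cast h.null_sum i
  have h1 : ∑ i, ∑ j, (C i j : ℚ) * δ j * ((x i : ℚ) ^ 2 / δ i) = 0 := by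
    simp_rw [← Finset.sum_mul, hn]; simp
  have h2 : ∑ i, ∑ j, (C i j : ℚ) * δ i * ((x j : ℚ) ^ 2 / δ j) = 0 := by
    rw [Finset.sum_comm]
    simp_rw [fun i j => hs.apply i j]
    exact h1
  have h3 : ((x ⬝ᵥ C *ᵥ x : ℤ) : ℚ) = ∑ i, ∑ j, (C i j : ℚ) * x i * x j := by
    simp only [dotProduct, mulVec, Finset.mul_sum]
    push_cast
    exact Finset.sum_congr rfl fun i _ => Finset.sum_congr rfl fun j _ => by ring
  have h4 : ∀ i j, -(C i j : ℚ) * ((x i : ℚ) * δ j - x j * δ i) ^ 2 / (δ i * δ j) =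
      2 * ((C i j : ℚ) * x i * x j) - (C i j : ℚ) * δ j * ((x i : ℚ) ^ 2 / δ i) -
        (C i j : ℚ) * δ i * ((x j : ℚ) ^ 2 / δ j) := fun i j => by
    have := hδ i
    have := hδ j
    field_simp
    ring
  simp_rw [h4, Finset.sum_sub_distrib, h1, h2, h3, Finset.mul_sum]
  ring

theorem form_term_nonneg (h : IsAffineMatrix C δ) (x : I → ℤ) (i j : I) :
    0 ≤ -(C i j : ℚ) * ((x i : ℚ) * δ j - x j * δ i) ^ 2 / (δ i * δ j) := by
  have h1 : (0 : ℚ) < δ i := by exact_mod_cast h.pos i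
  have h2 : (0 : ℚ) < δ j := by exact_mod_cast h.pos j
  by_cases hij : i = j
  · subst hij; simp
  · have : (C i j : ℚ) ≤ 0 := by exact_mod_cast h.nonpos i j hij
    have : 0 ≤ -(C i j : ℚ) := by linarith
    positivity

theorem form_nonneg (h : IsAffineMatrix C δ) (hs : C.IsSymm) (x : I → ℤ) :
    0 ≤ x ⬝ᵥ C *ᵥ x := by
  have h1 := h.two_form_eq hs x
  have h2 : (0 : ℚ) ≤ 2 * ((x ⬝ᵥ C *ᵥ x : ℤ) : ℚ) := by
    rw [h1]
    exact Finset.sum_nonneg fun i _ => Finset.sum_nonneg fun j _ => h.form_term_nonneg x i j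
  have h3 : (0 : ℚ) ≤ ((x ⬝ᵥ C *ᵥ x : ℤ) : ℚ) := by linarith
  exact_mod_cast h3

/-- In the sum of squares every term vanishes, so the ratio of `x` to `δ` is the same at both ends
of each edge, and the graph is connected. -/
theorem proportional_of_form_eq_zero (h : IsAffineMatrix C δ) (hs : C.IsSymm) {x : I → ℤ}
    (hx : x ⬝ᵥ C *ᵥ x = 0) (i j : I) : x i * δ j = x j * δ i := by
  have h1 := h.two_form_eq hs x
  rw [hx, Int.cast_zero, mul_zero, eq_comm, Finset.sum_eq_zero_iff_of_nonneg
    fun i _ => Finset.sum_nonneg fun j _ => h.form_term_nonneg x i j] at h1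
  have h2 : ∀ a b, C a b ≠ 0 → x a * δ b = x b * δ a := fun a b hab => by
    have h3 := (Finset.sum_eq_zero_iff_of_nonneg fun j _ => h.form_term_nonneg x a j).1
      (h1 a (Finset.mem_univ a)) b (Finset.mem_univ b)
    have ha : (δ a : ℚ) ≠ 0 := by exact_mod_cast (h.pos a).ne'
    have hb : (δ b : ℚ) ≠ 0 := by exact_mod_cast (h.pos b).ne'
    have hc : (C a b : ℚ) ≠ 0 := by exact_mod_cast hab
    have h4 : ((x a : ℚ) * δ b - x b * δ a) = 0 := by simpa [ha, hb, hc] using h3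
    have h5 : (x a : ℚ) * δ b = x b * δ a := by linarith
    exact_mod_cast h5
  induction h.conn i j with
  | refl => rfl
  | @tail a b _ hab ih =>
    apply mul_left_cancel₀ (h.pos a).ne'
    linear_combination δ b * ih + δ i * h2 a b hab

/-- The form of a symmetric integral matrix with even diagonal is even. -/
theorem even_form (h : IsAffineMatrix C δ) (hs : C.IsSymm) (x : I → ℤ) :
    Even (x ⬝ᵥ C *ᵥ x) := by
  rw [← ZMod.intCast_eq_zero_iff_even]
  have h1 : ((x ⬝ᵥ C *ᵥ x : ℤ) : ZMod 2) =
      ∑ p : I × I, (x p.1 * C p.1 p.2 * x p.2 : ZMod 2) := by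
    rw [Fintype.sum_prod_type]
    simp only [dotProduct, mulVec, Finset.mul_sum]
    push_cast
    exact Finset.sum_congr rfl fun i _ => Finset.sum_congr rfl fun j _ => by ring
  rw [h1]
  have h20 : (2 : ZMod 2) = 0 := rfl
  refine Finset.sum_involution (fun p _ => p.swap) (fun p _ => ?_) (fun p _ hp hp' => hp ?_)
    (fun _ _ => Finset.mem_univ _) (fun _ _ => rfl)
  · simp only [Prod.fst_swap, Prod.snd_swap, hs.apply p.1 p.2]
    linear_combination (x p.1 * C p.1 p.2 * x p.2 : ZMod 2) * h20
  · have : p.1 = p.2 := congrArg Prod.snd hp'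
    rw [this, h.diag, Int.cast_ofNat, h20]
    ring

theorem form_comm (hs : C.IsSymm) (x y : I → ℤ) : x ⬝ᵥ C *ᵥ y = y ⬝ᵥ C *ᵥ x := by
  rw [dotProduct_mulVec, ← mulVec_transpose, hs.eq, dotProduct_comm]

/-- Vectors of norm `2` are positive or negative. -/
theorem nonneg_or_nonpos (h : IsAffineMatrix C δ) (hs : C.IsSymm) {x : I → ℤ}
    (hx : x ⬝ᵥ C *ᵥ x = 2) : 0 ≤ x ∨ x ≤ 0 := by
  have hd : x⁺ - x⁻ = x := posPart_sub_negPart x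
  have hp : 0 ≤ x⁺ := posPart_nonneg x
  have hn : 0 ≤ x⁻ := negPart_nonneg x
  -- The two parts have disjoint supports, so only the nonpositive off-diagonal entries contribute.
  have hc : x⁺ ⬝ᵥ C *ᵥ x⁻ ≤ 0 := by
    simp only [dotProduct, mulVec, Finset.mul_sum]
    refine Finset.sum_nonpos fun i _ => Finset.sum_nonpos fun j _ => ?_
    by_cases hij : i = j
    · subst hij
      have : x⁺ i * x⁻ i = 0 := by
        simp only [Pi.posPart_apply, Pi.negPart_apply]
        rcases le_total 0 (x i) with h0 | h0 <;> simp [h0]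
      apply le_of_eq
      linear_combination C i i * this
    · have := mul_nonneg (hp i) (hn j)
      have := h.nonpos i j hij
      simp only at *
      nlinarith
  have he : x⁺ ⬝ᵥ C *ᵥ x⁺ + x⁻ ⬝ᵥ C *ᵥ x⁻ ≤ 2 := by
    rw [← hd, mulVec_sub, sub_dotProduct, dotProduct_sub, dotProduct_sub,
      form_comm hs x⁻ x⁺] at hx
    linarith
  -- An isotropic `y` is a multiple of `δ`, so it is zero or has full support; in the latter case
  -- `z` is zero.
  have aux : ∀ {y z : I → ℤ}, 0 ≤ y → 0 ≤ z → (∀ i, y i = 0 ∨ z i = 0) →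
      y ⬝ᵥ C *ᵥ y = 0 → y = 0 ∨ z = 0 := by
    intro y z hy hz hyz hq
    by_contra! hne
    obtain ⟨i, hi⟩ := Function.ne_iff.1 hne.1
    obtain ⟨j, hj⟩ := Function.ne_iff.1 hne.2
    have := h.proportional_of_form_eq_zero hs hq i j
    rw [(hyz j).resolve_right hj, zero_mul] at this
    exact (mul_eq_zero.1 this).elim hi (h.pos j).ne'
  have hdisj : ∀ i, x⁺ i = 0 ∨ x⁻ i = 0 := fun i => by
    simp only [Pi.posPart_apply, Pi.negPart_apply]
    rcases le_total 0 (x i) with h0 | h0 <;> simp [h0]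
  have hcases : x⁺ = 0 ∨ x⁻ = 0 := by
    -- Two even nonnegative integers with sum at most `2` cannot both be nonzero.
    obtain ⟨a, ha⟩ := h.even_form hs x⁺
    obtain ⟨b, hb⟩ := h.even_form hs x⁻
    have h1 := h.form_nonneg hs x⁺
    have h2 := h.form_nonneg hs x⁻
    by_cases ha0 : a = 0
    · exact aux hp hn hdisj (by omega)
    · exact (aux hn hp (fun i => (hdisj i).symm) (by omega)).symm
  rcases hcases with h0 | h0
  · right; rw [← hd, h0]; simp
  · left; rw [← hd, h0]; simp

theorem form_sub_null (h : IsAffineMatrix C δ) (hs : C.IsSymm) (x : I → ℤ) (c : ℤ) :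
    (x - c • δ) ⬝ᵥ C *ᵥ (x - c • δ) = x ⬝ᵥ C *ᵥ x := by
  have h1 : δ ⬝ᵥ C *ᵥ x = 0 := by rw [form_comm hs, h.null, dotProduct_zero]
  simp only [mulVec_sub, mulVec_smul, h.null, sub_dotProduct, smul_dotProduct, h1,
    smul_zero, sub_zero]

/-- This turns an upper bound `x ≤ δ` for a root `x` into positivity of the root `δ - x`. -/
theorem form_null_sub (h : IsAffineMatrix C δ) (hs : C.IsSymm) (x : I → ℤ) :
    (δ - x) ⬝ᵥ C *ᵥ (δ - x) = x ⬝ᵥ C *ᵥ x := by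
  have h1 : δ ⬝ᵥ C *ᵥ x = 0 := by rw [form_comm hs, h.null, dotProduct_zero]
  simp [mulVec_sub, h.null, h1]

end IsAffineMatrix

/-! ### Reflections, frames, termination and the final configuration. -/

namespace IsAffineMatrix

open Matrix

variable {I : Type*} [Fintype I] [DecidableEq I] {C : Matrix I I ℤ} {δ : I → ℤ} {o : I}

/-- The simple reflection in the root lattice. -/
def reflection (h : IsAffineMatrix C δ) (k : I) : (I → ℤ) ≃ₗ[ℤ] (I → ℤ) :=
  LinearEquiv.ofInvolutive
    (LinearMap.id - (LinearMap.toSpanSingleton ℤ (I → ℤ) (Pi.single k 1)).comp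
      ((LinearMap.proj k).comp C.mulVecLin))
    (fun x => by
      ext j
      have hk : (C *ᵥ Pi.single k 1) k = 2 := by simp [h.diag]
      simp only [LinearMap.sub_apply, LinearMap.id_apply, LinearMap.comp_apply,
        LinearMap.toSpanSingleton_apply, LinearMap.proj_apply, mulVecLin_apply, mulVec_sub,
        mulVec_smul, Pi.sub_apply, Pi.smul_apply, smul_eq_mul, hk]
      ring)

theorem reflection_apply (h : IsAffineMatrix C δ) (k : I) (x : I → ℤ) :
    h.reflection k x = x - (C *ᵥ x) k • Pi.single k 1 := rfl

theorem reflection_reflection (h : IsAffineMatrix C δ) (k : I) (x : I → ℤ) :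
    h.reflection k (h.reflection k x) = x :=
  (h.reflection k).symm_apply_apply x

theorem reflection_apply_of_ne (h : IsAffineMatrix C δ) {k j : I} (hj : j ≠ k) (x : I → ℤ) :
    h.reflection k x j = x j := by
  simp [reflection_apply, hj]

theorem reflection_null (h : IsAffineMatrix C δ) (k : I) : h.reflection k δ = δ := by
  simp [reflection_apply, h.null]

theorem form_reflection (h : IsAffineMatrix C δ) (hs : C.IsSymm) (k : I) (x y : I → ℤ) :
    h.reflection k x ⬝ᵥ C *ᵥ h.reflection k y = x ⬝ᵥ C *ᵥ y := by
  have h1 : x ⬝ᵥ C *ᵥ Pi.single k 1 = (C *ᵥ x) k := by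
    rw [form_comm hs, single_one_dotProduct]
  simp only [reflection_apply, mulVec_sub, mulVec_smul, sub_dotProduct, dotProduct_sub,
    smul_dotProduct, dotProduct_smul, h1, single_one_dotProduct, smul_eq_mul]
  simp [h.diag]
  ring

theorem form_simple (h : IsAffineMatrix C δ) (k : I) :
    Pi.single k 1 ⬝ᵥ C *ᵥ Pi.single k 1 = 2 := by
  simp [h.diag]

/-- If a simple reflection makes a positive vector of norm `2` negative, then this vector is the
simple root. -/
theorem reflection_nonneg (h : IsAffineMatrix C δ) (hs : C.IsSymm) {k : I} {x : I → ℤ}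
    (hx : 0 ≤ x) (hq : x ⬝ᵥ C *ᵥ x = 2) (hk : x ≠ Pi.single k 1) : 0 ≤ h.reflection k x := by
  refine (h.nonneg_or_nonpos hs (by rw [h.form_reflection hs, hq])).resolve_right fun hn => hk ?_
  -- The reflection changes the coordinate `k` only, so a nonpositive image leaves no other nonzero
  -- coordinate of `x`; norm `2` then forces `x k = 1`.
  have hxk : x = x k • Pi.single k 1 := by
    ext j
    by_cases hj : j = k
    · subst hj; simp
    · have := hn j
      rw [h.reflection_apply_of_ne hj] at this
      have h2 := le_antisymm this (hx j)
      simpa [hj] using h2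
  have h3 : x k * x k = 1 := by
    rw [hxk, mulVec_smul, smul_dotProduct, dotProduct_smul, h.form_simple, smul_eq_mul,
      smul_eq_mul] at hq
    linarith
  have h4 := hx k
  simp only [Pi.zero_apply] at h4
  have : x k = 1 := by nlinarith
  rw [hxk, this, one_smul]

variable (δ o) in
/-- The level zero configuration with amplitude `1` outside `o`. -/
def coweight : I → ℤ := fun j => if j = o then -∑ k ∈ Finset.univ.erase o, δ k else 1

variable (C) in
/-- Firing a vertex. -/
def firing (k : I) (v : I → ℤ) : I → ℤ := fun j => v j - C k j * v k

theorem coweight_dotProduct (ho : δ o = 1) : coweight δ o ⬝ᵥ δ = 0 := by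
  rw [dotProduct, ← Finset.add_sum_erase _ _ (Finset.mem_univ o), Finset.sum_congr rfl
    (g := δ) fun j hj => by rw [coweight, if_neg (Finset.ne_of_mem_erase hj), one_mul]]
  simp [coweight, ho]

/-- Firing is the transpose of the simple reflection, so the numbers game is the dual action of the
Weyl group. -/
theorem firing_dotProduct (h : IsAffineMatrix C δ) (k : I) (v x : I → ℤ) :
    firing C k v ⬝ᵥ x = v ⬝ᵥ h.reflection k x := by
  rw [reflection_apply, dotProduct_sub, dotProduct_smul, dotProduct_single_one]
  simp only [dotProduct, firing, mulVec, smul_eq_mul, sub_mul, Finset.sum_sub_distrib,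
    Finset.sum_mul]
  congr 1
  exact Finset.sum_congr rfl fun j _ => by ring

/-- The configuration `v` is the image of the initial configuration `coweight δ o` under an
element `w` of the affine Weyl group for which the vectors `w α_j`, `j ≠ o`, lie between
`0` and `δ`. -/
structure Frame (C : Matrix I I ℤ) (δ : I → ℤ) (o : I) (v : I → ℤ)
    (w : (I → ℤ) ≃ₗ[ℤ] (I → ℤ)) : Prop where
  isom : ∀ x y, w x ⬝ᵥ C *ᵥ w y = x ⬝ᵥ C *ᵥ y
  null : w δ = δ
  nonneg : ∀ j, j ≠ o → 0 ≤ w (Pi.single j 1)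
  le : ∀ j, j ≠ o → w (Pi.single j 1) ≤ δ
  pair : ∀ x, v ⬝ᵥ w x = coweight δ o ⬝ᵥ x
  cong : ∀ (N : ℤ) (x : I → ℤ), (∀ k, N ∣ (C *ᵥ x) k) → ∀ k, N ∣ w x k - x k

theorem frame_coweight (h : IsAffineMatrix C δ) :
    Frame C δ o (coweight δ o) (LinearEquiv.refl ℤ _) where
  isom _ _ := rfl
  null := rfl
  nonneg j _ := by simp
  le j _ k := by
    have := h.pos k
    by_cases hk : k = j
    · subst hk; simpa using Int.add_one_le_of_lt this
    · simpa [hk] using this.le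
  pair _ := rfl
  cong N x _ k := by simp

namespace Frame

variable {v : I → ℤ} {w : (I → ℤ) ≃ₗ[ℤ] (I → ℤ)}

theorem pair_symm (f : Frame C δ o v w) (k : I) :
    v k = coweight δ o ⬝ᵥ w.symm (Pi.single k 1) := by
  rw [← f.pair, LinearEquiv.apply_symm_apply, dotProduct_single_one]

/-- This is where the threshold `-1` matters: the lower bound fails only for `v k = 1`, the upper
bound only for `v k = -1`. -/
theorem fire (h : IsAffineMatrix C δ) (hs : C.IsSymm) (ho : δ o = 1) (f : Frame C δ o v w)
    {k : I} (hk : v k < -1) : Frame C δ o (firing C k v) (w.trans (h.reflection k)) where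
  isom x y := by simp [h.form_reflection hs, f.isom]
  null := by simp [f.null, h.reflection_null]
  nonneg j hj := by
    refine h.reflection_nonneg (x := w _) hs (f.nonneg j hj) (by rw [f.isom, h.form_simple]) fun he => ?_
    have := f.pair (Pi.single j 1)
    rw [he, dotProduct_single_one, dotProduct_single_one, coweight, if_neg hj] at this
    omega
  le j hj := by
    have h0 : 0 ≤ h.reflection k (δ - w (Pi.single j 1)) := by
      refine h.reflection_nonneg hs (sub_nonneg.2 (f.le j hj))
        (by rw [h.form_null_sub hs, f.isom, h.form_simple]) fun he => ?_
      have := f.pair (δ - Pi.single j 1)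
      rw [map_sub, f.null, he, dotProduct_single_one, dotProduct_sub, dotProduct_single_one,
        coweight_dotProduct ho, coweight, if_neg hj] at this
      omega
    rw [map_sub, h.reflection_null] at h0
    exact sub_nonneg.1 h0
  pair x := by
    rw [h.firing_dotProduct, LinearEquiv.trans_apply, h.reflection_reflection, f.pair]
  cong N x hx j := by
    have h1 := f.cong N x hx
    -- Since `w x ≡ x` modulo `N`, also `C (w x) ≡ C x ≡ 0`, so the reflection subtracts a multiple
    -- of `N`.
    have h2 : N ∣ (C *ᵥ w x) k := by
      have h3 : (C *ᵥ w x) k = ∑ j, C k j * (w x j - x j) + (C *ᵥ x) k := by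
        simp only [mulVec, dotProduct, ← Finset.sum_add_distrib]
        exact Finset.sum_congr rfl fun j _ => by ring
      rw [h3]
      exact dvd_add (Finset.dvd_sum fun j _ => (h1 j).mul_left _) (hx k)
    rw [LinearEquiv.trans_apply, reflection_apply]
    have h4 : (w x - (C *ᵥ w x) k • (Pi.single k 1 : I → ℤ)) j - x j =
        (w x j - x j) - (C *ᵥ w x) k * (Pi.single k 1 : I → ℤ) j := by
      simp only [Pi.sub_apply, Pi.smul_apply, smul_eq_mul]; ring
    rw [h4]
    exact dvd_sub (h1 j) (h2.mul_right _)

end Frame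

/-- A primitive of a positive multiple of the initial configuration. -/
theorem exists_primitive (h : IsAffineMatrix C δ) (hs : C.IsSymm) (ho : δ o = 1) :
    ∃ (N : ℤ) (ξ : I → ℤ), 0 < N ∧ ξ o = 0 ∧ C *ᵥ ξ = N • coweight δ o := by
  -- Replacing row `o` by the condition on `ξ o` makes the matrix invertible: a vector in its kernel
  -- is isotropic, hence a multiple of `δ`, and vanishes at `o`.
  let M : Matrix I I ℤ := C.updateRow o (Pi.single o 1)
  have hMo : ∀ x : I → ℤ, (M *ᵥ x) o = x o := fun x => by simp [M, mulVec]
  have hMne : ∀ (x : I → ℤ) (j), j ≠ o → (M *ᵥ x) j = (C *ᵥ x) j := fun x j hj => by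
    simp [M, mulVec, hj]
  have hM : M.det ≠ 0 := fun hd => by
    obtain ⟨y, hy0, hy⟩ := exists_mulVec_eq_zero_iff.2 hd
    have hyo : y o = 0 := by rw [← hMo y, hy]; rfl
    have hq : y ⬝ᵥ C *ᵥ y = 0 := Finset.sum_eq_zero fun j _ => by
      by_cases hj : j = o
      · rw [hj, hyo, zero_mul]
      · rw [← hMne y j hj, hy, Pi.zero_apply, mul_zero]
    refine hy0 (funext fun j => ?_)
    have := h.proportional_of_form_eq_zero hs hq j o
    rwa [ho, hyo, zero_mul, mul_one] at this
  let r : I → ℤ := Function.update (coweight δ o) o 0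
  -- The additional factor `M.det` makes the multiplier a square, hence positive.
  let ξ : I → ℤ := M.det • M.adjugate *ᵥ r
  have hξ : M *ᵥ ξ = (M.det * M.det) • r := by
    simp only [ξ, mulVec_smul, mulVec_mulVec, mul_adjugate, smul_mulVec, one_mulVec, smul_smul]
  have hξo : ξ o = 0 := by rw [← hMo ξ, hξ]; simp [r]
  have hne : ∀ j, j ≠ o → (C *ᵥ ξ) j = M.det * M.det * coweight δ o j := fun j hj => by
    rw [← hMne ξ j hj, hξ]; simp [r, hj]
  refine ⟨M.det * M.det, ξ, mul_self_pos.2 hM, hξo, funext fun j => ?_⟩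
  by_cases hj : j = o
  · subst hj
    -- The row `o` that was removed is recovered from the others, because both sides are orthogonal
    -- to `δ`.
    have h1 : C *ᵥ ξ ⬝ᵥ δ = 0 := by
      rw [dotProduct_comm, form_comm hs, h.null, dotProduct_zero]
    have h2 : ((M.det * M.det) • coweight δ j) ⬝ᵥ δ = 0 := by
      rw [smul_dotProduct, coweight_dotProduct ho, smul_zero]
    rw [dotProduct, ← Finset.add_sum_erase _ _ (Finset.mem_univ j), ho, mul_one] at h1 h2
    have h3 : ∑ k ∈ Finset.univ.erase j, (C *ᵥ ξ) k * δ k =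
        ∑ k ∈ Finset.univ.erase j, ((M.det * M.det) • coweight δ j) k * δ k :=
      Finset.sum_congr rfl fun k hk => by
        rw [hne k (Finset.ne_of_mem_erase hk)]; simp
    linarith
  · rw [hne j hj]; simp

variable (C) in
/-- One move of the strategy. -/
def Move (v v' : I → ℤ) : Prop := ∃ k, v k < -1 ∧ v' = firing C k v

namespace Frame

variable {v : I → ℤ} {w : (I → ℤ) ≃ₗ[ℤ] (I → ℤ)}

theorem map_eq_sum (w : (I → ℤ) ≃ₗ[ℤ] (I → ℤ)) (x : I → ℤ) :
    w x = ∑ j, x j • w (Pi.single j 1) := by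
  conv_lhs => rw [pi_eq_sum_univ' x, map_sum]
  exact Finset.sum_congr rfl fun j _ => by rw [map_smul]

theorem height_nonneg (f : Frame C δ o v w) {j : I} (hj : j ≠ o) :
    0 ≤ ∑ k, w (Pi.single j 1) k :=
  Finset.sum_nonneg fun k _ => f.nonneg j hj k

/-- The bound is strict because `w α_j` has norm `2` while `δ` has norm `0`. The gain of one is what
makes the inequalities at a final configuration sharp. -/
theorem height_lt (h : IsAffineMatrix C δ) (f : Frame C δ o v w) {j : I} (hj : j ≠ o) :
    ∑ k, w (Pi.single j 1) k < ∑ k, δ k := by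
  have hne : w (Pi.single j 1) ≠ δ := fun he => by
    have h1 := f.isom (Pi.single j 1) (Pi.single j 1)
    rw [he, h.null, dotProduct_zero, h.form_simple] at h1
    exact absurd h1 (by norm_num)
  obtain ⟨i, hi⟩ := Function.ne_iff.1 hne
  exact Finset.sum_lt_sum (fun k _ => f.le j hj k)
    ⟨i, Finset.mem_univ i, lt_of_le_of_ne (f.le j hj i) hi⟩

theorem height_le (h : IsAffineMatrix C δ) (f : Frame C δ o v w) {ξ : I → ℤ} (hξ : ξ o = 0) :
    ∑ k, w ξ k ≤ ∑ j, |ξ j| * ∑ k, δ k := by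
  rw [map_eq_sum w ξ]
  simp only [Finset.sum_apply, Pi.smul_apply, smul_eq_mul]
  rw [Finset.sum_comm]
  refine Finset.sum_le_sum fun j _ => ?_
  rw [← Finset.mul_sum]
  by_cases hj : j = o
  · subst hj; simp [hξ]
  · have h1 := f.height_nonneg hj
    have h2 := f.height_lt h hj
    exact (mul_le_mul_of_nonneg_right (le_abs_self _) h1).trans
      (mul_le_mul_of_nonneg_left h2.le (abs_nonneg _))

/-- By invariance of the form, `w ξ` is a primitive of `N v`. So the amplitude at `k` is, up to the
factor `N`, what the reflection at `k` takes off the height of `w ξ`. -/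
theorem mulVec_map (f : Frame C δ o v w) {N : ℤ} {ξ : I → ℤ}
    (hξ : C *ᵥ ξ = N • coweight δ o) (k : I) : (C *ᵥ w ξ) k = N * v k := by
  have h1 : (C *ᵥ w ξ) k = Pi.single k 1 ⬝ᵥ C *ᵥ w ξ := by rw [single_one_dotProduct]
  have h2 := f.isom (w.symm (Pi.single k 1)) ξ
  rw [LinearEquiv.apply_symm_apply] at h2
  rw [h1, h2, hξ, dotProduct_smul, f.pair_symm, dotProduct_comm, smul_eq_mul]

/-- The height of `w ξ` is a bounded integer that increases with every move; the induction is on a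
natural number exceeding its distance from the bound. -/
theorem acc (h : IsAffineMatrix C δ) (hs : C.IsSymm) (ho : δ o = 1) (f : Frame C δ o v w) :
    Acc (fun v' v => Move C v v') v := by
  obtain ⟨N, ξ, hN, hξo, hξ⟩ := h.exists_primitive hs ho
  obtain ⟨n, hn⟩ : ∃ n : ℕ, ∑ j, |ξ j| * ∑ k, δ k - ∑ k, w ξ k < n :=
    (exists_nat_gt (∑ j, |ξ j| * ∑ k, δ k - ∑ k, w ξ k))
  induction n generalizing v w with
  | zero => have := f.height_le h hξo; push_cast at hn; omega
  | succ n ih =>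
    refine ⟨v, ?_⟩
    rintro _ ⟨k, hk, rfl⟩
    refine ih (f.fire h hs ho hk) ?_
    have h1 : ∑ j, (w.trans (h.reflection k)) ξ j = ∑ j, w ξ j - N * v k := by
      rw [LinearEquiv.trans_apply, reflection_apply, f.mulVec_map hξ]
      simp only [Pi.sub_apply, Pi.smul_apply, Finset.sum_sub_distrib, smul_eq_mul,
        ← Finset.mul_sum, Finset.sum_pi_single', Finset.mem_univ, if_true, mul_one]
    rw [h1]
    push_cast at hn
    nlinarith

/-- Where the strategy stops. -/
theorem eq_neg_coweight (h : IsAffineMatrix C δ) (hs : C.IsSymm) (ho : δ o = 1)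
    (f : Frame C δ o v w) (hv : ∀ k, -1 ≤ v k) :
    ∃ i, δ i = 1 ∧ v = -coweight δ i ∧
      ∀ (N : ℤ) (x : I → ℤ), (∀ k, N ∣ (C *ᵥ x) k) →
        N ∣ ∑ k, x k - (∑ k, δ k - 1) * x i - x o := by
  set H := ∑ k, δ k with hH
  let b : I → I → ℤ := fun k => w.symm (Pi.single k 1)
  have hb : ∀ k, b k ⬝ᵥ C *ᵥ b k = 2 := fun k => by
    rw [← f.isom]; simp [b, h.diag]
  have hw : ∀ k, w (b k - b k o • δ) = Pi.single k 1 - b k o • δ := fun k => by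
    rw [map_sub, map_smul, f.null, LinearEquiv.apply_symm_apply]
  -- The finite part of the root `w⁻¹ α_k`: subtracting a multiple of `δ` removes `α_o` and changes
  -- neither the norm nor the pairing with `ρ^(o)`. Hence `v k` is the height of `m k`.
  let m : I → I → ℤ := fun k => b k - b k o • δ
  have hm : ∀ k, m k ⬝ᵥ C *ᵥ m k = 2 := fun k => by rw [← hb k]; exact h.form_sub_null hs _ _
  have hmo : ∀ k, m k o = 0 := fun k => by simp [m, ho]
  have hvm : ∀ k, v k = ∑ j, m k j := fun k => by
    have h1 : v k = coweight δ o ⬝ᵥ m k := by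
      rw [f.pair_symm, dotProduct_sub, dotProduct_smul, coweight_dotProduct ho]; simp [b]
    rw [h1]
    refine Finset.sum_congr rfl fun j _ => ?_
    by_cases hj : j = o
    · rw [hj, hmo, mul_zero]
    · rw [coweight, if_neg hj, one_mul]
  have hht : ∀ k, ∑ j, m k j * ∑ i, w (Pi.single j 1) i = 1 - b k o * H := fun k => by
    have h1 : ∑ i, w (m k) i = ∑ j, m k j * ∑ i, w (Pi.single j 1) i := by
      rw [map_eq_sum w (m k)]
      simp only [Finset.sum_apply, Pi.smul_apply, smul_eq_mul]
      rw [Finset.sum_comm]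
      simp only [Finset.mul_sum]
    rw [← h1, hw k]
    simp only [Pi.sub_apply, Pi.smul_apply, Finset.sum_sub_distrib, smul_eq_mul,
        ← Finset.mul_sum, Finset.sum_pi_single', Finset.mem_univ, if_true, hH]
  have hH0 : 0 < H := Finset.sum_pos (fun i _ => h.pos i) ⟨o, Finset.mem_univ o⟩
  -- If `m k` is positive, each `w α_j` in it contributes height at most `H - 1`. If it is negative,
  -- `w (m k)` has height at most `0`, so `b k o ≥ 1`, and `v k ≥ -1` suffices.
  have hz : ∀ k, 1 ≤ (H - 1) * v k + H * b k o := fun k => by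
    rcases h.nonneg_or_nonpos hs (hm k) with h0 | h0
    · have h1 : ∑ j, m k j * ∑ i, w (Pi.single j 1) i ≤ ∑ j, m k j * (H - 1) :=
        Finset.sum_le_sum fun j _ => by
          by_cases hj : j = o
          · rw [hj, hmo, zero_mul, zero_mul]
          · exact mul_le_mul_of_nonneg_left (Int.le_sub_one_of_lt (f.height_lt h hj)) (h0 j)
      rw [hht, ← Finset.sum_mul, ← hvm] at h1
      linarith
    · have h1 : ∑ j, m k j * ∑ i, w (Pi.single j 1) i ≤ 0 :=
        Finset.sum_nonpos fun j _ => by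
          by_cases hj : j = o
          · rw [hj, hmo, zero_mul]
          · exact mul_nonpos_of_nonpos_of_nonneg (h0 j) (f.height_nonneg hj)
      rw [hht] at h1
      have h2 : 1 ≤ b k o := by nlinarith
      have h3 := hv k
      nlinarith
  have hsymm : ∀ x : I → ℤ, w.symm x o = ∑ k, x k * b k o := fun x => by
    rw [map_eq_sum w.symm x]
    simp only [Finset.sum_apply, Pi.smul_apply, smul_eq_mul, b]
  have hδb : ∑ k, δ k * b k o = 1 := by
    rw [← hsymm, ← ho]
    conv_lhs => rw [← f.null, LinearEquiv.symm_apply_apply]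
  have hδv : ∑ k, δ k * v k = 0 := by
    have h1 := f.pair δ
    rwa [f.null, coweight_dotProduct ho, dotProduct_comm] at h1
  -- With weights `δ k` the left sides add up to `H = ∑ δ k`, so none of the inequalities `hz` is
  -- strict.
  have hz1 : ∀ k, (H - 1) * v k + H * b k o = 1 := by
    have h1 : ∑ k, δ k * ((H - 1) * v k + H * b k o - 1) = 0 := by
      have h2 : ∀ k, δ k * ((H - 1) * v k + H * b k o - 1) =
          (H - 1) * (δ k * v k) + H * (δ k * b k o) - δ k := fun k => by ring
      simp only [h2, Finset.sum_sub_distrib, Finset.sum_add_distrib, ← Finset.mul_sum, hδb, hδv]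
      linarith
    intro k
    have h3 := (Finset.sum_eq_zero_iff_of_nonneg fun k _ =>
      mul_nonneg (h.pos k).le (sub_nonneg.2 (hz k))).1 h1 k (Finset.mem_univ k)
    linarith [(mul_eq_zero.1 h3).resolve_left (h.pos k).ne']
  have ht : ∀ k, H * (v k + b k o) = 1 + v k := fun k => by linarith [hz1 k]
  have ht0 : ∀ k, 0 ≤ v k + b k o := fun k =>
    nonneg_of_mul_nonneg_right (by rw [ht]; linarith [hv k]) hH0
  have hδt : ∑ k, δ k * (v k + b k o) = 1 := by
    simp only [mul_add, Finset.sum_add_distrib, hδb, hδv, zero_add]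
  -- Nonnegative integers with positive integral weights and weighted sum `1`: exactly one is
  -- nonzero, and it and its weight are both `1`.
  obtain ⟨i, -, hi⟩ := Finset.exists_ne_zero_of_sum_ne_zero (hδt.trans_ne one_ne_zero)
  have hi1 : 1 ≤ v i + b i o := by
    have h1 := ht0 i
    have : v i + b i o ≠ 0 := right_ne_zero_of_mul hi
    omega
  have hsplit := hδt
  rw [← Finset.add_sum_erase _ _ (Finset.mem_univ i)] at hsplit
  have hrest : 0 ≤ ∑ k ∈ Finset.univ.erase i, δ k * (v k + b k o) :=
    Finset.sum_nonneg fun k _ => mul_nonneg (h.pos k).le (ht0 k)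
  have hδi := h.pos i
  have hδi1 : δ i = 1 := by nlinarith
  have hti : v i + b i o = 1 := by rw [hδi1] at hsplit; linarith
  have htk : ∀ k, k ≠ i → v k + b k o = 0 := fun k hk => by
    rw [hδi1, hti, one_mul, add_eq_left, Finset.sum_eq_zero_iff_of_nonneg fun k _ =>
      mul_nonneg (h.pos k).le (ht0 k)] at hsplit
    exact (mul_eq_zero.1 (hsplit k (Finset.mem_erase.2 ⟨hk, Finset.mem_univ k⟩))).resolve_left
      (h.pos k).ne'
  refine ⟨i, hδi1, funext fun k => ?_, fun N x hx => ?_⟩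
  · rw [Pi.neg_apply, coweight]
    by_cases hk : k = i
    · subst hk
      have h1 := ht k
      have h2 := Finset.add_sum_erase Finset.univ δ (Finset.mem_univ k)
      rw [if_pos rfl]
      rw [hti] at h1
      linarith
    · have h1 := ht k
      rw [htk k hk] at h1
      rw [if_neg hk]
      linarith
  · have h1 : w.symm x o = ∑ k, x k - (H - 1) * x i := by
      -- All coefficients `b k o` are now known: `1` for `k ≠ i`, and `2 - H` for `k = i`.
      rw [hsymm, ← Finset.add_sum_erase _ _ (Finset.mem_univ i),
        ← Finset.add_sum_erase Finset.univ x (Finset.mem_univ i)]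
      have h2 : ∀ k ∈ Finset.univ.erase i, x k * b k o = x k := fun k hk => by
        have h3 := htk k (Finset.ne_of_mem_erase hk)
        have h4 := ht k
        rw [h3] at h4
        have h5 : b k o = 1 := by linarith
        rw [h5, mul_one]
      have h6 : b i o = 2 - H := by
        have h7 := ht i
        rw [hti] at h7
        linarith
      rw [Finset.sum_congr rfl h2, h6]
      ring
    choose u hu using f.cong N x hx
    have h2 : x - w.symm x = N • w.symm u := by
      rw [← map_smul, ← show w x - x = N • u from funext hu, map_sub,
        LinearEquiv.symm_apply_apply]
    have h3 := congrFun h2 o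
    simp only [Pi.sub_apply, Pi.smul_apply, smul_eq_mul] at h3
    rw [← h1]
    exact ⟨-(w.symm u o), by linarith⟩

end Frame

theorem exists_frame (h : IsAffineMatrix C δ) (hs : C.IsSymm) (ho : δ o = 1) {v : I → ℤ}
    (hv : Relation.ReflTransGen (Move C) (coweight δ o) v) : ∃ w, Frame C δ o v w := by
  induction hv with
  | refl => exact ⟨_, h.frame_coweight⟩
  | tail _ hm ih =>
    obtain ⟨w, hw⟩ := ih
    obtain ⟨k, hk, rfl⟩ := hm
    exact ⟨_, hw.fire h hs ho hk⟩

end IsAffineMatrix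

/-! ### Congruences, foldings and extending vertices. -/

namespace AffineType

open Matrix

variable {X Y : AffineType}

/-- Termination provides a final configuration, which equals both negatives; and `ρ^(j)` determines
`j`, the only vertex where it is nonpositive. -/
theorem Obtains.eq {i j k : X.Vertex} (hδ : ∀ i, 0 < X.delta i) (hj : X.Obtains i j)
    (hk : X.Obtains i k) : j = k := by
  have hfin : ∀ v, Acc (fun w v => X.Step v w) v →
      ∃ w, Relation.ReflTransGen X.Step v w ∧ X.IsFinal w := fun v hv => by
    induction hv with
    | intro v _ ih =>
      by_cases hf : X.IsFinal v
      · exact ⟨v, .refl, hf⟩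
      · obtain ⟨i, hi⟩ := not_forall.1 hf
        obtain ⟨w, hw, hwf⟩ := ih (X.fire i v) ⟨i, not_le.1 hi, rfl⟩
        exact ⟨w, .head ⟨i, not_le.1 hi, rfl⟩ hw, hwf⟩
  obtain ⟨v, hv, hvf⟩ := hfin _ hj.1
  have h1 : X.rho j = X.rho k := neg_injective ((hj.2 v hv hvf).symm.trans (hk.2 v hv hvf))
  by_contra hne
  have h2 := congrFun h1 j
  simp only [rho, if_true, if_neg hne] at h2
  have : 0 ≤ ∑ k ∈ Finset.univ.erase j, X.delta k := Finset.sum_nonneg fun k _ => (hδ k).le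
  omega

/-- In the simply laced case, congruences determine the outcome of the strategy. -/
theorem obtains_of_congruences (h : IsAffineMatrix X.cartan X.delta) (hs : X.cartan.IsSymm)
    {i j : X.Vertex} (hi : X.delta i = 1)
    (hj : ∀ k, X.delta k = 1 →
      (∀ (N : ℤ) (x : X.Vertex → ℤ), (∀ a, N ∣ (X.cartan *ᵥ x) a) →
        N ∣ ∑ a, x a - (∑ a, X.delta a - 1) * x k - x i) → k = j) : X.Obtains i j := by
  refine ⟨h.frame_coweight.acc h hs hi, fun v hv hf => ?_⟩
  obtain ⟨w, hw⟩ := h.exists_frame hs hi hv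
  obtain ⟨k, hk, rfl, hN⟩ := hw.eq_neg_coweight h hs hi hf
  rw [hj k hk hN]
  rfl

/-- `π` exhibits the Cartan matrix of `X` as a quotient of that of `Y`. -/
structure IsFolding (π : Y.Vertex → X.Vertex) : Prop where
  surjective : Function.Surjective π
  indep : ∀ a b, π a = π b → a ≠ b → Y.cartan a b = 0
  cartan : ∀ i b, ∑ a with π a = i, Y.cartan a b = X.cartan i (π b)
  delta : ∀ i, ∑ a with π a = i, Y.delta a = X.delta i

namespace IsFolding

variable {π : Y.Vertex → X.Vertex}

/-- Rows and null vector of the quotient are sums over fibres. Since fibres contain no edges,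
nothing cancels and connectedness descends. -/
theorem isAffineMatrix (f : IsFolding π) (h : IsAffineMatrix Y.cartan Y.delta) :
    IsAffineMatrix X.cartan X.delta where
  diag i := by
    obtain ⟨b, rfl⟩ := f.surjective i
    rw [← f.cartan, Finset.sum_eq_single b, h.diag]
    · exact fun a ha hab => f.indep a b (Finset.mem_filter.1 ha).2 hab
    · simp
  nonpos i j hij := by
    obtain ⟨b, rfl⟩ := f.surjective j
    rw [← f.cartan]
    exact Finset.sum_nonpos fun a ha => h.nonpos a b fun hab =>
      hij (by rw [← (Finset.mem_filter.1 ha).2, hab])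
  pos i := by
    obtain ⟨b, rfl⟩ := f.surjective i
    rw [← f.delta]
    exact Finset.sum_pos (fun a _ => h.pos a) ⟨b, by simp⟩
  null := by
    funext i
    simp only [mulVec, dotProduct, ← f.delta, Finset.mul_sum, Pi.zero_apply]
    have h1 : ∀ j, ∑ b with π b = j, X.cartan i j * Y.delta b =
        ∑ b with π b = j, X.cartan i (π b) * Y.delta b := fun j =>
      Finset.sum_congr rfl fun b hb => by rw [(Finset.mem_filter.1 hb).2]
    simp only [h1]
    rw [Finset.sum_fiberwise]
    simp only [← f.cartan, Finset.sum_mul]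
    rw [Finset.sum_comm]
    exact Finset.sum_eq_zero fun a _ => h.null_sum a
  conn i j := by
    obtain ⟨a, rfl⟩ := f.surjective i
    obtain ⟨b, rfl⟩ := f.surjective j
    refine Relation.ReflTransGen.lift π (fun a b hab => ?_) _ _ (h.conn a b)
    change X.cartan (π a) (π b) ≠ 0
    rw [← f.cartan]
    by_cases hπ : π a = π b
    · have hab' : a = b := by_contra fun hne => hab (f.indep a b hπ hne)
      subst hab'
      rw [Finset.sum_eq_single a]
      · exact hab
      · exact fun c hc hca => f.indep c a (Finset.mem_filter.1 hc).2 hca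
      · simp
    · refine (Finset.sum_neg' (fun c hc => h.nonpos c b ?_) ⟨a, by simp, ?_⟩).ne
      · rintro rfl
        exact hπ (Finset.mem_filter.1 hc).2.symm
      · exact lt_of_le_of_ne (h.nonpos a b fun hne => hπ (by rw [hne])) hab

theorem step (f : IsFolding π) {v w : X.Config} (h : X.Step v w) :
    Relation.TransGen Y.Step (v ∘ π) (w ∘ π) := by
  obtain ⟨i, hi, rfl⟩ := h
  -- The vertices of a fibre are pairwise nonadjacent, so firing some of them leaves the amplitude
  -- `v i < -1` at the others.
  have key : ∀ s : Finset Y.Vertex, (∀ a ∈ s, π a = i) → s.Nonempty →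
      Relation.TransGen Y.Step (v ∘ π) (fun b => v (π b) - ∑ a ∈ s, Y.cartan a b * v i) := by
    intro s
    induction s using Finset.induction_on with
    | empty => intro _ h; exact absurd h (by simp)
    | insert a s has ih =>
      intro hs _
      have ha : π a = i := hs a (Finset.mem_insert_self a s)
      have hs' : ∀ c ∈ s, π c = i := fun c hc => hs c (Finset.mem_insert_of_mem hc)
      have h0 : ∑ c ∈ s, Y.cartan c a * v i = 0 := Finset.sum_eq_zero fun c hc => by
        rw [f.indep c a (by rw [ha, hs' c hc]) (fun he => has (he ▸ hc)), zero_mul]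
      have hstep : Y.Step (fun b => v (π b) - ∑ c ∈ s, Y.cartan c b * v i)
          (fun b => v (π b) - ∑ c ∈ insert a s, Y.cartan c b * v i) := by
        refine ⟨a, by simp only [h0, ha, sub_zero]; exact hi, funext fun b => ?_⟩
        simp only [fire, h0, ha, sub_zero, Finset.sum_insert has]
        ring
      by_cases hne : s.Nonempty
      · exact (ih hs' hne).tail hstep
      · rw [Finset.not_nonempty_iff_eq_empty.1 hne] at hstep ⊢
        simp only [Finset.sum_empty, sub_zero] at hstep
        exact .single hstep
  obtain ⟨b, hb⟩ := f.surjective i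
  have h1 := key (Finset.univ.filter fun a => π a = i) (by simp) ⟨b, by simp [hb]⟩
  have h2 : X.fire i v ∘ π =
      fun b => v (π b) - ∑ a with π a = i, Y.cartan a b * v i := by
    funext b
    simp only [Function.comp_apply, fire, ← Finset.sum_mul, f.cartan]
  rwa [h2]

theorem rho_comp (f : IsFolding π) {a : Y.Vertex} (ha : ∀ b, π b = π a → b = a) :
    X.rho (π a) ∘ π = Y.rho a := by
  have hsum : ∑ i ∈ Finset.univ.erase (π a), X.delta i = ∑ b ∈ Finset.univ.erase a, Y.delta b := by
    have h1 := Finset.add_sum_erase Finset.univ X.delta (Finset.mem_univ (π a))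
    have h2 := Finset.add_sum_erase Finset.univ Y.delta (Finset.mem_univ a)
    have h3 : X.delta (π a) = Y.delta a := by
      rw [← f.delta, Finset.sum_eq_single a]
      · exact fun b hb hba => absurd (ha b (Finset.mem_filter.1 hb).2) hba
      · simp
    have h4 : ∑ i, X.delta i = ∑ b, Y.delta b := by
      simp only [← f.delta]
      exact Finset.sum_fiberwise _ _ _
    omega
  funext b
  by_cases hb : b = a
  · subst hb
    simp only [Function.comp_apply, rho, if_true, hsum]
  · have hb' : π b ≠ π a := fun h => hb (ha b h)
    simp only [Function.comp_apply, rho, if_neg hb, if_neg hb']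

/-- Configurations of `X` pull back to configurations constant on fibres; moves, final
configurations and, for one-element fibres, the `ρ`'s are respected, and pulling back is injective.
-/
theorem obtains (f : IsFolding π) {a b : Y.Vertex}
    (ha : ∀ c, π c = π a → c = a) (hb : ∀ c, π c = π b → c = b) (h : Y.Obtains a b) :
    X.Obtains (π a) (π b) := by
  constructor
  · have h1 := h.1.transGen
    rw [← f.rho_comp ha] at h1
    have h2 : ∀ u, Acc (Relation.TransGen fun w v => Y.Step v w) u → ∀ v : X.Config,
        v ∘ π = u → Acc (fun w v => X.Step v w) v := fun u hu => by
      induction hu with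
      | intro u _ ih =>
        rintro v rfl
        exact ⟨v, fun w hw => ih _ (Relation.transGen_swap.1 (f.step hw)) w rfl⟩
    exact h2 _ h1 _ rfl
  · intro v hv hf
    have h1 : Relation.ReflTransGen Y.Step (Y.rho a) (v ∘ π) := by
      rw [← f.rho_comp ha]
      clear hf
      induction hv with
      | refl => exact .refl
      | tail _ hs ih => exact ih.trans (f.step hs).to_reflTransGen
    have h2 := h.2 _ h1 fun c => hf (π c)
    rw [← f.rho_comp hb] at h2
    funext i
    obtain ⟨c, rfl⟩ := f.surjective i
    exact congrFun h2 c

end IsFolding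

theorem isExtending_zero (hX : X.IsValid) : X.IsExtending 0 :=
  ⟨X, hX, Equiv.refl _, fun _ _ => rfl, rfl⟩

theorem IsExtending.of_apply {σ : X.Vertex ≃ X.Vertex}
    (hσ : ∀ i j, X.cartan (σ i) (σ j) = X.cartan i j) {i : X.Vertex}
    (hi : X.IsExtending (σ i)) : X.IsExtending i := by
  obtain ⟨Y, hY, e, he, h0⟩ := hi
  exact ⟨Y, hY, σ.trans e, fun j k => by simp [he, hσ], h0⟩

theorem delta_zero (hX : X.IsValid) : X.delta 0 = 1 := by
  cases X <;> rfl

/-- The null vector of `Y`, pulled back to `X`, is `1` at `i` and proportional to `δ`. Comparison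
with the vertex `0`, where `δ` is `1`, shows that `δ i` divides `1`; it is not needed that `Y = X`.
-/
theorem delta_eq_one_of_isExtending
    (hA : ∀ Z : AffineType, Z.IsValid → IsAffineMatrix Z.cartan Z.delta)
    (hX : X.IsValid) {i : X.Vertex} (hi : X.IsExtending i) : X.delta i = 1 := by
  obtain ⟨Y, hY, e, he, h0⟩ := hi
  have h1 : X.cartan *ᵥ (Y.delta ∘ e) = 0 := funext fun j => by
    simp only [mulVec, dotProduct, Function.comp_apply, ← he]
    rw [Equiv.sum_comp e fun k => Y.cartan (e j) k * Y.delta k]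
    exact (hA Y hY).null_sum _
  have h2 := (hA X hX).proportional_of_null h1 i 0
  rw [Function.comp_apply, h0, delta_zero hX, delta_zero hY, one_mul] at h2
  exact Int.eq_one_of_mul_eq_one_left ((hA X hX).pos i).le h2.symm

theorem graph_adj (i j : X.Vertex) :
    X.graph.Adj i j ↔ i ≠ j ∧ (X.cartan i j ≠ 0 ∨ X.cartan j i ≠ 0) :=
  SimpleGraph.fromRel_adj _ _ _

/-- The graph automorphism induced by an automorphism of the Cartan matrix. -/
def graphAut (σ : X.Vertex ≃ X.Vertex) (hσ : ∀ i j, X.cartan (σ i) (σ j) = X.cartan i j) :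
    X.graph ≃g X.graph where
  toEquiv := σ
  map_rel_iff' {i j} := by simp [graph_adj, hσ]

end AffineType

/-! ### The simply laced matrices are affine. -/

open Matrix in
theorem IsAffineMatrix.of_parent {I : Type*} [Fintype I] {C : Matrix I I ℤ} {δ : I → ℤ}
    (hdiag : ∀ i, C i i = 2) (hnonpos : ∀ i j, i ≠ j → C i j ≤ 0) (hpos : ∀ i, 0 < δ i)
    (hnull : ∀ i, ∑ j, C i j * δ j = 0) (hs : C.IsSymm) (r : I) (par : I → I) (d : I → ℕ)
    (hpar : ∀ i, i ≠ r → C i (par i) ≠ 0 ∧ d (par i) < d i) : IsAffineMatrix C δ where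
  diag := hdiag
  nonpos := hnonpos
  pos := hpos
  null := funext hnull
  conn i j := by
    have key : ∀ i, Relation.ReflTransGen (fun a b => C a b ≠ 0) i r := fun i => by
      induction hd : d i using Nat.strong_induction_on generalizing i with
      | _ n ih =>
        by_cases hi : i = r
        · subst hi; exact .refl
        · obtain ⟨h1, h2⟩ := hpar i hi
          exact .head h1 (ih _ (hd ▸ h2) _ rfl)
    have hsw : ∀ a b, C a b ≠ 0 → C b a ≠ 0 := fun a b h => by rwa [hs.apply]
    exact (key i).trans (Relation.ReflTransGen.mono (fun a b h => hsw b a h) _ _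
      (Relation.reflTransGen_swap.2 (key j)))

namespace AffineType

open Matrix

theorem isSymm_of_apply {I : Type*} {C : Matrix I I ℤ} (h : ∀ i j, C j i = C i j) : C.IsSymm :=
  Matrix.ext h

/-- The entries of the Cartan matrix of `E6`, on an explicit index type. -/
def entryE6 : Fin 7 → Fin 7 → ℤ := E6.cartan

/-- The null vector of `E6`, on an explicit index type. -/
def deltaE6 : Fin 7 → ℤ := E6.delta

theorem isSymm_E6 : (Matrix.of entryE6).IsSymm :=
  isSymm_of_apply (by decide : ∀ i j, entryE6 j i = entryE6 i j)

theorem affine_E6 : IsAffineMatrix (Matrix.of entryE6) deltaE6 :=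
  .of_parent (by decide : ∀ i, entryE6 i i = 2) (by decide : ∀ i j, i ≠ j → entryE6 i j ≤ 0)
    (by decide) (by decide : ∀ i, ∑ j, entryE6 i j * deltaE6 j = 0) isSymm_E6 4
    -- The neighbour towards the branch vertex `4`, and the distance from it.
    ![2, 3, 4, 4, 4, 4, 5] ![2, 2, 1, 1, 0, 1, 2]
    (by decide : ∀ i : Fin 7, i ≠ 4 →
      entryE6 i ((![2, 3, 4, 4, 4, 4, 5] : Fin 7 → Fin 7) i) ≠ 0 ∧ _ < _)

/-- The entries of the Cartan matrix of `E7`, on an explicit index type. -/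
def entryE7 : Fin 8 → Fin 8 → ℤ := E7.cartan

/-- The null vector of `E7`, on an explicit index type. -/
def deltaE7 : Fin 8 → ℤ := E7.delta

theorem isSymm_E7 : (Matrix.of entryE7).IsSymm :=
  isSymm_of_apply (by decide : ∀ i j, entryE7 j i = entryE7 i j)

theorem affine_E7 : IsAffineMatrix (Matrix.of entryE7) deltaE7 :=
  .of_parent (by decide : ∀ i, entryE7 i i = 2) (by decide : ∀ i j, i ≠ j → entryE7 i j ≤ 0)
    (by decide) (by decide : ∀ i, ∑ j, entryE7 i j * deltaE7 j = 0) isSymm_E7 4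
    ![1, 3, 4, 4, 4, 4, 5, 6] ![3, 2, 1, 1, 0, 1, 2, 3]
    (by decide : ∀ i : Fin 8, i ≠ 4 →
      entryE7 i ((![1, 3, 4, 4, 4, 4, 5, 6] : Fin 8 → Fin 8) i) ≠ 0 ∧ _ < _)

/-- The entries of the Cartan matrix of `E8`, on an explicit index type. -/
def entryE8 : Fin 9 → Fin 9 → ℤ := E8.cartan

/-- The null vector of `E8`, on an explicit index type. -/
def deltaE8 : Fin 9 → ℤ := E8.delta

theorem isSymm_E8 : (Matrix.of entryE8).IsSymm :=
  isSymm_of_apply (by decide : ∀ i j, entryE8 j i = entryE8 i j)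

theorem affine_E8 : IsAffineMatrix (Matrix.of entryE8) deltaE8 :=
  .of_parent (by decide : ∀ i, entryE8 i i = 2) (by decide : ∀ i j, i ≠ j → entryE8 i j ≤ 0)
    (by decide) (by decide : ∀ i, ∑ j, entryE8 i j * deltaE8 j = 0) isSymm_E8 4
    ![8, 3, 4, 4, 4, 4, 5, 6, 7] ![5, 2, 1, 1, 0, 1, 2, 3, 4]
    (by decide : ∀ i : Fin 9, i ≠ 4 →
      entryE8 i ((![8, 3, 4, 4, 4, 4, 5, 6, 7] : Fin 9 → Fin 9) i) ≠ 0 ∧ _ < _)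

/-- The Cartan matrix of `Ã_n`, on an explicit index type. -/
def matrixA (n : ℕ) : Matrix (Fin (n + 1)) (Fin (n + 1)) ℤ := (A n).cartan

theorem matrixA_apply (n : ℕ) (i j : Fin (n + 1)) : matrixA n i j =
    (if i = j then 2 else 0) - (if i + 1 = j then 1 else 0) - (if j + 1 = i then 1 else 0) := rfl

theorem isSymm_A (n : ℕ) : (matrixA n).IsSymm := isSymm_of_apply fun i j => by
  rw [matrixA_apply, matrixA_apply]
  simp only [eq_comm (a := j) (b := i)]
  ring

theorem sum_matrixA (n : ℕ) (x : Fin (n + 1) → ℤ) (i : Fin (n + 1)) :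
    ∑ j : Fin (n + 1), matrixA n i j * x j = 2 * x i - x (i + 1) - x (i - 1) := by
  simp only [matrixA_apply, sub_mul, ite_mul, one_mul, zero_mul, Finset.sum_sub_distrib,
    Finset.sum_ite_eq, Finset.mem_univ, if_true]
  simp only [← eq_sub_iff_add_eq, Finset.sum_ite_eq', Finset.mem_univ, if_true]

theorem affine_A {n : ℕ} (hn : 1 ≤ n) : IsAffineMatrix (matrixA n) (fun _ => 1) := by
  obtain ⟨n, rfl⟩ : ∃ m, n = m + 1 := ⟨n - 1, by omega⟩
  have h1 : ∀ i : Fin (n + 1 + 1), i + 1 ≠ i := fun i h => by simp at h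
  refine .of_parent (fun i => ?_) (fun i j hij => ?_) (fun _ => one_pos)
    (fun i => ?_) (isSymm_A _) 0 (fun i : Fin (n + 1 + 1) => i - 1)
    (fun i : Fin (n + 1 + 1) => i.val) (fun i hi => ⟨?_, ?_⟩)
  · rw [matrixA_apply]; simp
  · rw [matrixA_apply, if_neg hij]; split_ifs <;> norm_num
  · exact (sum_matrixA _ _ i).trans (by simp)
  · have h2 := h1 (i - 1)
    rw [sub_add_cancel] at h2
    rw [matrixA_apply, sub_add_cancel, if_neg h2, if_pos rfl]
    split_ifs <;> norm_num
  · rw [Fin.coe_sub_one, if_neg hi]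
    have := Fin.val_ne_zero_iff.2 hi
    omega

/-- Entries of the Cartan matrix of `D̃_n`, for numbers as vertices. -/
def entryD (n a b : ℕ) : ℤ :=
  if a = b then 2
  else if (a = 0 ∧ b = 2) ∨ (b = 0 ∧ a = 2) then -1
  else if (a + 2 = n ∧ b = n) ∨ (b + 2 = n ∧ a = n) then -1
  else if (1 ≤ a ∧ a + 1 = b ∧ b + 1 ≤ n) ∨ (1 ≤ b ∧ b + 1 = a ∧ a + 1 ≤ n) then -1
  else 0

/-- The Cartan matrix of `D̃_n`, on an explicit index type. -/
def matrixD (n : ℕ) : Matrix (Fin (n + 1)) (Fin (n + 1)) ℤ := (D n).cartan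

theorem matrixD_apply (n : ℕ) (i j : Fin (n + 1)) : matrixD n i j = entryD n i j := by
  simp only [entryD, ← Fin.ext_iff]; rfl

theorem entryD_comm (n a b : ℕ) : entryD n a b = entryD n b a := by
  unfold entryD; grind (splits := 25)

/-- Each summand is supported at a single `b`, so that row sums can be evaluated term by term. -/
theorem entryD_mul (n a b : ℕ) (hn : 4 ≤ n) (ha : a ≤ n) (hb : b ≤ n) (t : ℤ) : entryD n a b * t =
    (if b = a then 2 * t else 0) - (if b = a + 1 then if 1 ≤ a ∧ a + 2 ≤ n then t else 0 else 0)
    - (if b = a - 1 then if 2 ≤ a ∧ a + 1 ≤ n then t else 0 else 0)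
    - (if b = 2 then if a = 0 then t else 0 else 0)
    - (if b = 0 then if a = 2 then t else 0 else 0)
    - (if b = n then if a + 2 = n then t else 0 else 0)
    - (if b = n - 2 then if a = n then t else 0 else 0) := by
  unfold entryD; grind (splits := 25)

theorem sum_entryD {n : ℕ} (hn : 4 ≤ n) (x : ℕ → ℤ) {a : ℕ} (ha : a ≤ n) :
    ∑ b ∈ Finset.range (n + 1), entryD n a b * x b = 2 * x a
      - (if 1 ≤ a ∧ a + 2 ≤ n then x (a + 1) else 0)
      - (if 2 ≤ a ∧ a + 1 ≤ n then x (a - 1) else 0) - (if a = 0 then x 2 else 0)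
      - (if a = 2 then x 0 else 0) - (if a + 2 = n then x n else 0)
      - (if a = n then x (n - 2) else 0) := by
  rw [Finset.sum_congr rfl fun b hb =>
    entryD_mul n a b hn ha (by simpa [Nat.lt_succ_iff] using hb) (x b)]
  simp only [Finset.sum_sub_distrib, Finset.sum_ite_eq', Finset.mem_range]
  rw [if_pos (by omega : a < n + 1), if_pos (by omega : a - 1 < n + 1),
    if_pos (by omega : 2 < n + 1), if_pos (by omega : 0 < n + 1), if_pos (by omega : n < n + 1),
    if_pos (by omega : n - 2 < n + 1)]
  congr 5
  split_ifs <;> first | rfl | omega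

theorem sum_matrixD {n : ℕ} (hn : 4 ≤ n) (x : ℕ → ℤ) (i : Fin (n + 1)) :
    ∑ j : Fin (n + 1), matrixD n i j * x j = 2 * x i
      - (if 1 ≤ i.val ∧ i.val + 2 ≤ n then x (i + 1) else 0)
      - (if 2 ≤ i.val ∧ i.val + 1 ≤ n then x (i - 1) else 0) - (if i.val = 0 then x 2 else 0)
      - (if i.val = 2 then x 0 else 0) - (if i.val + 2 = n then x n else 0)
      - (if i.val = n then x (n - 2) else 0) := by
  simp only [matrixD_apply]
  rw [Fin.sum_univ_eq_sum_range fun b => entryD n i b * x b]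
  exact sum_entryD hn x (Nat.lt_succ_iff.1 i.2)

/-- The null vector of `D̃_n`, on an explicit index type. -/
def deltaD (n : ℕ) : Fin (n + 1) → ℤ := (D n).delta

theorem deltaD_apply (n : ℕ) (i : Fin (n + 1)) :
    deltaD n i = if i.val ≤ 1 ∨ n ≤ i.val + 1 then 1 else 2 := rfl

theorem isSymm_D (n : ℕ) : (matrixD n).IsSymm := isSymm_of_apply fun i j => by
  rw [matrixD_apply, matrixD_apply, entryD_comm]

theorem affine_D {n : ℕ} (hn : 4 ≤ n) : IsAffineMatrix (matrixD n) (deltaD n) := by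
  refine .of_parent (fun i => ?_) (fun i j hij => ?_) (fun i => ?_)
    (fun i => ?_) (isSymm_D _) ⟨1, by omega⟩
    (fun i => ⟨if i.val = 0 then 2 else if i.val = n then n - 2 else i - 1,
      by have := i.2; split_ifs <;> omega⟩)
    -- The parent of `0` is `2`, so its depth has to exceed `2`.
    (fun i => if i.val = 0 then 3 else i) (fun i hi => ?_)
  · rw [matrixD_apply, entryD, if_pos rfl]
  · rw [matrixD_apply, entryD, if_neg fun h => hij (Fin.ext h)]; split_ifs <;> norm_num
  · rw [deltaD_apply]; split_ifs <;> norm_num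
  · refine (sum_matrixD hn (fun k => if k ≤ 1 ∨ n ≤ k + 1 then 1 else 2) i).trans ?_
    have := i.2
    grind (splits := 25)
  · have := i.2
    have h1 : i.val ≠ 1 := fun h => hi (Fin.ext h)
    rw [matrixD_apply]
    unfold entryD
    dsimp only
    grind (splits := 25)

end AffineType

/-! ### The outcome of the strategy for the simply laced types. -/

namespace AffineType

open Matrix

theorem two_mul_sum_val (n : ℕ) : 2 * ∑ k : Fin (n + 1), (k : ℤ) = n * (n + 1) := by
  rw [Fin.sum_univ_eq_sum_range fun k => (k : ℤ)]
  induction n with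
  | zero => simp
  | succ n ih =>
    rw [Finset.sum_range_succ, mul_add, ih]
    push_cast
    ring

/-- The vector `k ↦ k` is linear along the cycle, except for a jump by `n + 1` between the vertices
`n` and `0`. -/
theorem dvd_mulVec_val_A {n : ℕ} (hn : 1 ≤ n) (a : Fin (n + 1)) :
    ((n + 1 : ℕ) : ℤ) ∣ (matrixA n *ᵥ fun k : Fin (n + 1) => (k : ℤ)) a := by
  obtain ⟨n, rfl⟩ : ∃ m, n = m + 1 := ⟨n - 1, by omega⟩
  change _ ∣ ∑ j : Fin (n + 1 + 1), matrixA (n + 1) a j * (j : ℤ)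
  rw [sum_matrixA, Fin.coe_sub_one, Fin.val_add_one]
  split_ifs with h1 h2 h2
  · subst h1; simp [Fin.ext_iff] at h2
  · subst h1
    simp only [Fin.val_last]
    exact ⟨1, by push_cast; ring⟩
  · subst h2
    simp only [Fin.val_zero]
    exact ⟨-1, by push_cast; ring⟩
  · have := Fin.val_ne_zero_iff.2 h2
    exact ⟨0, by push_cast [Nat.cast_sub (Nat.one_le_iff_ne_zero.2 this)]; ring⟩

theorem obtains_A {n : ℕ} (hn : 1 ≤ n) {S : ℤ} (hS : 2 * S = n * (n + 1)) {i j : (A n).Vertex}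
    (hj : ∀ k : ℕ, k < n + 1 → (n + 1 : ℤ) ∣ S + k - i.val → k = j.val) :
    (A n).Obtains i j := by
  refine obtains_of_congruences (affine_A hn) (isSymm_A _) rfl fun k _ hk => ?_
  have h0 : ((n + 1 : ℕ) : ℤ) ∣ ∑ k : Fin (n + 1), (k : ℤ) - (∑ _ : Fin (n + 1), (1 : ℤ) - 1) * k.val
      - i.val := hk (n + 1 : ℕ) (fun k : Fin (n + 1) => (k : ℤ)) (dvd_mulVec_val_A hn)
  have h1 : ∑ k : Fin (n + 1), (k : ℤ) = S := by
    have := two_mul_sum_val n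
    omega
  obtain ⟨c, hc⟩ := h0
  -- Here `∑ δ - 1 = n ≡ -1` modulo `n + 1`, which turns `-n k` into `+k`.
  refine Fin.ext (hj _ k.2 ⟨c + k.val, ?_⟩)
  rw [h1] at hc
  simp only [Finset.sum_const, Finset.card_univ, Fintype.card_fin, nsmul_eq_mul, mul_one] at hc
  push_cast at hc
  linarith

theorem obtains_A_even {m : ℕ} (hm : 1 ≤ m) (i : (A (2 * m)).Vertex) :
    (A (2 * m)).Obtains i i := by
  refine obtains_A (by omega) (S := m * (2 * m + 1)) (by push_cast; ring) fun k hk hd => ?_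
  have hi : i.val < 2 * m + 1 := i.2
  have h1 : ((2 * m : ℕ) + 1 : ℤ) ∣ (k : ℤ) - i.val := by
    have := dvd_sub hd (Dvd.intro_left (m : ℤ) rfl)
    push_cast at this ⊢
    ring_nf at this ⊢
    exact this
  have := Int.eq_zero_of_abs_lt_dvd h1 (abs_lt.2 ⟨by omega, by omega⟩)
  omega

theorem obtains_A_odd {m : ℕ} (hm : 1 ≤ m) {i j : (A (2 * m - 1)).Vertex}
    (hj : j.val = (i.val + m) % (2 * m)) : (A (2 * m - 1)).Obtains i j := by
  obtain ⟨n, rfl⟩ : ∃ n, m = n + 1 := ⟨m - 1, by omega⟩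
  refine obtains_A (by omega) (S := (2 * n + 1) * (n + 1))
    (by push_cast [Nat.cast_sub (show 1 ≤ 2 * (n + 1) by omega)]; ring) fun k hk hd => ?_
  have hi : i.val < 2 * (n + 1) - 1 + 1 := i.2
  have h0 : ((2 * (n + 1) - 1 : ℕ) + 1 : ℤ) = 2 * (n + 1) := by omega
  -- `S` is an odd multiple of `n + 1`, half the length of the cycle; hence the antipode.
  have h1 : (2 * (n + 1) : ℤ) ∣ (k : ℤ) - i.val - (n + 1) := by
    rw [h0] at hd
    have := dvd_sub hd (Dvd.intro_left ((n + 1 : ℤ)) rfl)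
    ring_nf at this ⊢
    exact this
  have h2 : (2 * (n + 1) : ℤ) ∣ (k : ℤ) - j.val := by
    have h3 : (2 * (n + 1) : ℤ) ∣ ((i.val + (n + 1) : ℕ) : ℤ) - j.val := by
      rw [hj]
      push_cast
      exact Int.dvd_self_sub_emod
    have := dvd_add h1 h3
    push_cast at this
    ring_nf at this ⊢
    exact this
  have hj' : j.val < 2 * (n + 1) - 1 + 1 := j.2
  have := Int.eq_zero_of_abs_lt_dvd h2 (abs_lt.2 ⟨by omega, by omega⟩)
  omega

theorem obtains_E6 (i : Fin 7) (hi : deltaE6 i = 1) : E6.Obtains i i := by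
  refine obtains_of_congruences (X := E6) affine_E6 isSymm_E6 hi fun k hk hN => ?_
  -- A null vector modulo `3` whose values `0, 1, 2` at the vertices `0, 1, 6` tell these apart.
  have h1 := hN 3 ![0, 1, 0, 2, 0, 1, 2]
    (by decide : ∀ a, (3 : ℤ) ∣ ∑ j, entryE6 a j * (![0, 1, 0, 2, 0, 1, 2] : Fin 7 → ℤ) j)
  exact (by decide : ∀ i k : Fin 7, deltaE6 i = 1 → deltaE6 k = 1 →
    (3 : ℤ) ∣ ∑ a, (![0, 1, 0, 2, 0, 1, 2] : Fin 7 → ℤ) a - (∑ a, deltaE6 a - 1) *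
      (![0, 1, 0, 2, 0, 1, 2] : Fin 7 → ℤ) k - (![0, 1, 0, 2, 0, 1, 2] : Fin 7 → ℤ) i → k = i)
    i k hi hk h1

theorem obtains_E7 (i : Fin 8) (hi : deltaE7 i = 1) :
    E7.Obtains i ((![7, 6, 2, 5, 4, 3, 1, 0] : Fin 8 → Fin 8) i) := by
  refine obtains_of_congruences (X := E7) affine_E7 isSymm_E7 hi fun k hk hN => ?_
  -- A null vector modulo `2` that distinguishes `0` from `7`. Its coordinate sum is odd, and this
  -- forces the exchange.
  have h1 := hN 2 ![0, 0, 1, 0, 0, 1, 0, 1]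
    (by decide : ∀ a, (2 : ℤ) ∣ ∑ j, entryE7 a j * (![0, 0, 1, 0, 0, 1, 0, 1] : Fin 8 → ℤ) j)
  exact (by decide : ∀ i k : Fin 8, deltaE7 i = 1 → deltaE7 k = 1 →
    (2 : ℤ) ∣ ∑ a, (![0, 0, 1, 0, 0, 1, 0, 1] : Fin 8 → ℤ) a - (∑ a, deltaE7 a - 1) *
      (![0, 0, 1, 0, 0, 1, 0, 1] : Fin 8 → ℤ) k - (![0, 0, 1, 0, 0, 1, 0, 1] : Fin 8 → ℤ) i →
      k = (![7, 6, 2, 5, 4, 3, 1, 0] : Fin 8 → Fin 8) i)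
    i k hi hk h1

theorem obtains_E8 (i : Fin 9) (hi : deltaE8 i = 1) : E8.Obtains i i :=
  obtains_of_congruences (X := E8) affine_E8 isSymm_E8 hi fun k hk _ =>
    (by decide : ∀ i k : Fin 9, deltaE8 i = 1 → deltaE8 k = 1 → k = i) i k hi hk

/-- The permutation of the exterior vertices of `D̃_n` that is induced by the strategy. -/
def swapD (n a : ℕ) : ℕ :=
  if n % 4 ≤ 1 then a
  else if a = 0 then 1
  else if a = 1 then 0
  else if a + 1 = n then n
  else if a = n then n - 1
  else a

/-- A vector that is annihilated by the Cartan matrix of `D̃_n` modulo `4`. -/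
def spinD (n a : ℕ) : ℤ :=
  if n % 2 = 1 ∧ a + 1 = n then 1
  else if n % 2 = 1 ∧ a = n then -1
  else if a % 2 = 1 then 2
  else 0

theorem sum_odd_range (m : ℕ) :
    ∑ a ∈ Finset.range m, (if a % 2 = 1 then (2 : ℤ) else 0) = 2 * (m / 2 : ℕ) := by
  induction m with
  | zero => simp
  | succ m ih => rw [Finset.sum_range_succ, ih]; split_ifs <;> omega

theorem sum_spinD {n : ℕ} (hn : 1 ≤ n) :
    ∑ a ∈ Finset.range (n + 1), spinD n a = 2 * (n / 2 : ℕ) := by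
  obtain ⟨n, rfl⟩ : ∃ m, n = m + 1 := ⟨n - 1, by omega⟩
  have h1 : ∀ a ∈ Finset.range n, spinD (n + 1) a = if a % 2 = 1 then (2 : ℤ) else 0 :=
    fun a ha => by
      have := Finset.mem_range.1 ha
      unfold spinD
      rw [if_neg (by omega), if_neg (by omega)]
  rw [Finset.sum_range_succ, Finset.sum_range_succ, Finset.sum_congr rfl h1, sum_odd_range]
  unfold spinD
  split_ifs <;> omega

theorem sum_deltaD {n : ℕ} (hn : 4 ≤ n) : ∑ i, deltaD n i = 2 * n - 2 := by
  obtain ⟨n, rfl⟩ : ∃ m, n = m + 4 := ⟨n - 4, by omega⟩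
  simp only [deltaD_apply]
  rw [Fin.sum_univ_eq_sum_range fun a => if a ≤ 1 ∨ n + 4 ≤ a + 1 then (1 : ℤ) else 2,
    Finset.sum_range_succ, Finset.sum_range_succ, Finset.sum_range_succ', Finset.sum_range_succ',
    Finset.sum_congr rfl fun a ha => if_neg (by have := Finset.mem_range.1 ha; omega)]
  simp
  ring

/-- The congruence modulo `2` keeps `b` at the same end of the graph as `a`; the one modulo `4`
selects the vertex there, according to `n` modulo `4`. -/
theorem eq_swapD {n a b : ℕ} (hn : 4 ≤ n) (ha : a ≤ n) (hb : b ≤ n) (ha' : a ≤ 1 ∨ n ≤ a + 1)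
    (hb' : b ≤ 1 ∨ n ≤ b + 1)
    (h1 : (4 : ℤ) ∣ 2 * (n / 2 : ℕ) - (2 * n - 2 - 1) * spinD n b - spinD n a)
    (h2 : (2 : ℤ) ∣ 2 - (2 * n - 2 - 1) * (if b ≤ 1 then 1 else 0) - (if a ≤ 1 then 1 else 0)) :
    b = swapD n a := by
  have h3 : b ≤ 1 ↔ a ≤ 1 := by
    split_ifs at h2 with h4 h5 h5 <;> simp only [h4, h5] <;> omega
  clear h2
  have ha2 : a = 0 ∨ a = 1 ∨ a + 1 = n ∨ a = n := by omega
  have hb2 : b = 0 ∨ b = 1 ∨ b + 1 = n ∨ b = n := by omega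
  obtain ⟨q, hq⟩ : ∃ q, n = 4 * q ∨ n = 4 * q + 1 ∨ n = 4 * q + 2 ∨ n = 4 * q + 3 :=
    ⟨n / 4, by omega⟩
  have hval : ∀ c, c = 0 ∨ c = 1 ∨ c + 1 = n ∨ c = n →
      (n % 2 = 0 → c % 2 = 0 ∧ spinD n c = 0 ∨ c % 2 = 1 ∧ spinD n c = 2) ∧
      (n % 2 = 1 → c = 0 ∧ spinD n c = 0 ∨ c = 1 ∧ spinD n c = 2 ∨
        c + 1 = n ∧ spinD n c = 1 ∨ c = n ∧ spinD n c = -1) := by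
    intro c hc
    unfold spinD
    split_ifs <;> omega
  have hva := hval a ha2
  have hvb := hval b hb2
  clear hval
  generalize spinD n a = s at *
  generalize spinD n b = t at *
  unfold swapD
  rcases hq with rfl | rfl | rfl | rfl
  · rw [if_pos (by omega)]
    rw [show 4 * q / 2 = 2 * q by omega] at h1
    rcases hva.1 (by omega) with ⟨h5, rfl⟩ | ⟨h5, rfl⟩ <;>
      rcases hvb.1 (by omega) with ⟨h6, rfl⟩ | ⟨h6, rfl⟩ <;> push_cast at h1 <;> omega
  · rw [if_pos (by omega)]
    rw [show (4 * q + 1) / 2 = 2 * q by omega] at h1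
    rcases hva.2 (by omega) with ⟨h5, rfl⟩ | ⟨h5, rfl⟩ | ⟨h5, rfl⟩ | ⟨h5, rfl⟩ <;>
      rcases hvb.2 (by omega) with ⟨h6, rfl⟩ | ⟨h6, rfl⟩ | ⟨h6, rfl⟩ | ⟨h6, rfl⟩ <;>
      push_cast at h1 <;> omega
  · rw [if_neg (by omega)]
    rw [show (4 * q + 2) / 2 = 2 * q + 1 by omega] at h1
    rcases hva.1 (by omega) with ⟨h5, rfl⟩ | ⟨h5, rfl⟩ <;>
      rcases hvb.1 (by omega) with ⟨h6, rfl⟩ | ⟨h6, rfl⟩ <;> push_cast at h1 <;>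
      split_ifs <;> omega
  · rw [if_neg (by omega)]
    rw [show (4 * q + 3) / 2 = 2 * q + 1 by omega] at h1
    rcases hva.2 (by omega) with ⟨h5, rfl⟩ | ⟨h5, rfl⟩ | ⟨h5, rfl⟩ | ⟨h5, rfl⟩ <;>
      rcases hvb.2 (by omega) with ⟨h6, rfl⟩ | ⟨h6, rfl⟩ | ⟨h6, rfl⟩ | ⟨h6, rfl⟩ <;>
      push_cast at h1 <;> split_ifs <;> omega

theorem obtains_D {n : ℕ} (hn : 4 ≤ n) {i j : Fin (n + 1)} (hi : deltaD n i = 1)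
    (hj : j.val = swapD n i) : (D n).Obtains i j := by
  suffices h : ∀ k : Fin (n + 1), deltaD n k = 1 →
      (∀ (N : ℤ) (x : ℕ → ℤ), (∀ a : Fin (n + 1), N ∣ ∑ b : Fin (n + 1), matrixD n a b * x b) →
        N ∣ ∑ a : Fin (n + 1), x a - (∑ a, deltaD n a - 1) * x k - x i) → k = j from
    obtains_of_congruences (X := D n) (affine_D hn) (isSymm_D n) hi fun k hk hN =>
      h k hk fun N x hx => hN N (fun a : Fin (n + 1) => x a) hx
  intro k hk hN
  have key : ∀ (N : ℤ) (x : ℕ → ℤ), (∀ a : Fin (n + 1), N ∣ ∑ b : Fin (n + 1), matrixD n a b * x b) →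
      N ∣ ∑ a ∈ Finset.range (n + 1), x a - (2 * n - 2 - 1) * x k.val - x i.val := fun N x hx => by
    rw [← sum_deltaD hn, ← Fin.sum_univ_eq_sum_range x]
    exact hN N x hx
  have h1 := key 4 (spinD n) fun a => by
    have := a.2
    rw [sum_matrixD hn]
    unfold spinD
    grind (splits := 25)
  have h2 := key 2 (fun a => if a ≤ 1 then 1 else 0) fun a => by
    have := a.2
    rw [sum_matrixD hn fun a => if a ≤ 1 then 1 else 0]
    grind (splits := 25)
  have h3 : ∑ a ∈ Finset.range (n + 1), (if a ≤ 1 then (1 : ℤ) else 0) = 2 := by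
    obtain ⟨n, rfl⟩ : ∃ m, n = m + 1 := ⟨n - 1, by omega⟩
    rw [Finset.sum_range_succ', Finset.sum_range_succ']
    simp
  rw [sum_spinD (by omega)] at h1
  rw [h3] at h2
  rw [deltaD_apply] at hi hk
  refine Fin.ext (hj ▸ eq_swapD hn (Nat.lt_succ_iff.1 i.2) (Nat.lt_succ_iff.1 k.2) ?_ ?_ h1 h2)
  · by_contra h; rw [if_neg h] at hi; omega
  · by_contra h; rw [if_neg h] at hk; omega

end AffineType

/-! ### The types with multiple bonds, as foldings. -/

namespace AffineType

open Matrix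

/-- Entries of the Cartan matrix of `B̃_n`, for numbers as vertices. -/
def entryB (n a b : ℕ) : ℤ :=
  if a = b then 2
  else if a = n ∧ b + 1 = n then -2
  else if (a = 0 ∧ b = 2) ∨ (b = 0 ∧ a = 2) then -1
  else if (1 ≤ a ∧ a + 1 = b) ∨ (1 ≤ b ∧ b + 1 = a) then -1
  else 0

theorem cartan_B (n : ℕ) (i j : (B n).Vertex) : (B n).cartan i j = entryB n i.val j.val := by
  simp only [entryB, ← Fin.ext_iff]; rfl

/-- Entries of the Cartan matrix of `C̃_n`, for numbers as vertices. -/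
def entryC (n a b : ℕ) : ℤ :=
  if a = b then 2
  else if a = 1 ∧ b = 0 then -2
  else if a + 1 = n ∧ b = n then -2
  else if a + 1 = b ∨ b + 1 = a then -1
  else 0

theorem cartan_C (n : ℕ) (i j : (C n).Vertex) : (C n).cartan i j = entryC n i.val j.val := by
  simp only [entryC, ← Fin.ext_iff]; rfl

/-- Entries of the Cartan matrix of the cycle with `N` vertices, for numbers as vertices. -/
def entryA (N a b : ℕ) : ℤ :=
  if a = b then 2
  else if a + 1 = b ∨ b + 1 = a ∨ (a = 0 ∧ b + 1 = N) ∨ (b = 0 ∧ a + 1 = N) then -1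
  else 0

theorem matrixA_eq_entryA {n : ℕ} (hn : 2 ≤ n) (i j : Fin (n + 1)) :
    matrixA n i j = entryA (n + 1) i j := by
  obtain ⟨n, rfl⟩ : ∃ m, n = m + 1 := ⟨n - 1, by omega⟩
  rw [matrixA_apply]
  unfold entryA
  have hi := i.2
  have hj := j.2
  simp only [Fin.ext_iff, Fin.val_add_one, Fin.val_last]
  grind (splits := 25)

/-- The folding of `D̃_{n+1}` onto `B̃_n`. -/
def foldB (n : ℕ) (a : Fin (n + 1 + 1)) : Fin (n + 1) := ⟨min a n, by omega⟩

theorem sum_foldB (n : ℕ) (f : ℕ → ℤ) (i : Fin (n + 1)) :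
    ∑ a : Fin (n + 1 + 1) with foldB n a = i, f a = f i + if i.val = n then f (n + 1) else 0 := by
  have h1 : ∀ a ∈ Finset.range (n + 1 + 1), (if min a n = i.val then f a else 0) =
      (if a = i.val then f a else 0) + if a = n + 1 then if i.val = n then f a else 0 else 0 :=
    fun a ha => by
      have := Finset.mem_range.1 ha
      have := i.2
      grind
  simp only [Finset.sum_filter, foldB, Fin.ext_iff]
  rw [Fin.sum_univ_eq_sum_range fun a => if min a n = i.val then f a else 0,
    Finset.sum_congr rfl h1, Finset.sum_add_distrib, Finset.sum_ite_eq', Finset.sum_ite_eq',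
    if_pos (Finset.mem_range.2 (by omega)), if_pos (Finset.mem_range.2 (by omega))]

theorem isFolding_B {n : ℕ} (hn : 3 ≤ n) :
    IsFolding (X := B n) (Y := D (n + 1)) (foldB n) where
  surjective i := ⟨(⟨i.val, by have : i.val < n + 1 := i.2; omega⟩ : Fin (n + 1 + 1)), Fin.ext
    (Nat.min_eq_left (Nat.lt_succ_iff.1 i.2))⟩
  indep a b hab hne := by
    have h1 : min a.val n = min b.val n := congrArg Fin.val hab
    have h2 : a.val ≠ b.val := fun h => hne (Fin.ext h)
    have ha : a.val < n + 1 + 1 := a.2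
    have hb : b.val < n + 1 + 1 := b.2
    refine (matrixD_apply (n + 1) a b).trans ?_
    unfold entryD
    grind (splits := 25)
  cartan i b := by
    refine (Finset.sum_congr rfl fun a _ => matrixD_apply (n + 1) a b).trans
      ((sum_foldB n (fun a => entryD (n + 1) a b.val) i).trans ?_)
    refine Eq.trans ?_ (cartan_B n i (foldB n b)).symm
    have hi : i.val < n + 1 := i.2
    have hb : b.val < n + 1 + 1 := b.2
    change _ = entryB n i.val (min b.val n)
    unfold entryD entryB
    grind (splits := 25)
  delta i := by
    refine (sum_foldB n (fun a => if a ≤ 1 ∨ n + 1 ≤ a + 1 then 1 else 2) i).trans ?_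
    have hi : i.val < n + 1 := i.2
    change _ = if i.val ≤ 1 then 1 else 2
    grind (splits := 25)

/-- The folding of `Ã_{2n-1}` onto `C̃_n`. -/
def foldC (n : ℕ) (a : Fin (2 * n - 1 + 1)) : Fin (n + 1) := ⟨min a (2 * n - a), by omega⟩

theorem sum_foldC {n : ℕ} (hn : 1 ≤ n) (f : ℕ → ℤ) (i : Fin (n + 1)) :
    ∑ a : Fin (2 * n - 1 + 1) with foldC n a = i, f a =
      f i + if i.val ≠ 0 ∧ i.val ≠ n then f (2 * n - i.val) else 0 := by
  have h1 : ∀ a ∈ Finset.range (2 * n - 1 + 1), (if min a (2 * n - a) = i.val then f a else 0) =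
      (if a = i.val then f a else 0) +
        if a = 2 * n - i.val then if i.val ≠ 0 ∧ i.val ≠ n then f a else 0 else 0 :=
    fun a ha => by
      have := Finset.mem_range.1 ha
      have := i.2
      grind
  simp only [Finset.sum_filter, foldC, Fin.ext_iff]
  rw [Fin.sum_univ_eq_sum_range fun a => if min a (2 * n - a) = i.val then f a else 0,
    Finset.sum_congr rfl h1, Finset.sum_add_distrib, Finset.sum_ite_eq', Finset.sum_ite_eq',
    if_pos (Finset.mem_range.2 (by omega))]
  have := i.2
  congr 1
  simp only [Finset.mem_range]
  split_ifs <;> first | rfl | omega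

theorem isFolding_C {n : ℕ} (hn : 2 ≤ n) :
    IsFolding (X := C n) (Y := A (2 * n - 1)) (foldC n) where
  surjective i := ⟨(⟨i.val, by have : i.val < n + 1 := i.2; omega⟩ : Fin (2 * n - 1 + 1)), Fin.ext
    (Nat.min_eq_left (by have : i.val < n + 1 := i.2; dsimp only; omega))⟩
  indep a b hab hne := by
    have h1 : min a.val (2 * n - a.val) = min b.val (2 * n - b.val) := congrArg Fin.val hab
    have h2 : a.val ≠ b.val := fun h => hne (Fin.ext h)
    have ha : a.val < 2 * n - 1 + 1 := a.2
    have hb : b.val < 2 * n - 1 + 1 := b.2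
    refine (matrixA_eq_entryA (by omega) a b).trans ?_
    unfold entryA
    split_ifs <;> omega
  cartan i b := by
    refine (Finset.sum_congr rfl fun a _ => matrixA_eq_entryA (n := 2 * n - 1) (by omega) a b).trans
      ((sum_foldC (n := n) (by omega) (fun a => entryA (2 * n - 1 + 1) a b.val) i).trans ?_)
    refine Eq.trans ?_ (cartan_C n i (foldC n b)).symm
    have hi : i.val < n + 1 := i.2
    have hb : b.val < 2 * n - 1 + 1 := b.2
    change _ = entryC n i.val (min b.val (2 * n - b.val))
    unfold entryA entryC
    grind (splits := 25)
  delta i := by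
    refine (sum_foldC (n := n) (by omega) (fun _ => 1) i).trans ?_
    have hi : i.val < n + 1 := i.2
    change _ = if i.val = 0 ∨ i.val = n then 1 else 2
    grind (splits := 25)

/-- The entries of the Cartan matrix of `F4`, on an explicit index type. -/
def entryF4 : Fin 5 → Fin 5 → ℤ := F4.cartan

/-- The null vector of `F4`, on an explicit index type. -/
def deltaF4 : Fin 5 → ℤ := F4.delta

/-- The folding of `Ẽ_6` onto `F̃_4`. -/
def foldF4 : Fin 7 → Fin 5 := ![0, 4, 1, 3, 2, 3, 4]

theorem isFolding_F4 : IsFolding (X := F4) (Y := E6) foldF4 where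
  surjective := (by decide : Function.Surjective foldF4)
  indep := (by decide : ∀ a b, foldF4 a = foldF4 b → a ≠ b → entryE6 a b = 0)
  cartan := (by decide : ∀ i b, ∑ a with foldF4 a = i, entryE6 a b =
    entryF4 i (foldF4 b))
  delta := (by decide : ∀ i, ∑ a with foldF4 a = i, deltaE6 a = deltaF4 i)

/-- The entries of the Cartan matrix of `G2`, on an explicit index type. -/
def entryG2 : Fin 3 → Fin 3 → ℤ := G2.cartan

/-- The null vector of `G2`, on an explicit index type. -/
def deltaG2 : Fin 3 → ℤ := G2.delta

/-- The entries of the Cartan matrix of `D̃_4`, on an explicit index type. -/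
def entryD4 : Fin 5 → Fin 5 → ℤ := (D 4).cartan

/-- The null vector of `D̃_4`, on an explicit index type. -/
def deltaD4 : Fin 5 → ℤ := (D 4).delta

/-- The folding of `D̃_4` onto `G̃_2`. -/
def foldG2 : Fin 5 → Fin 3 := ![0, 2, 1, 2, 2]

theorem isFolding_G2 : IsFolding (X := G2) (Y := D 4) foldG2 where
  surjective := (by decide : Function.Surjective foldG2)
  indep := (by decide : ∀ a b : Fin 5, foldG2 a = foldG2 b → a ≠ b →
    entryD4 a b = 0)
  cartan := (by decide : ∀ i b, ∑ a with foldG2 a = i, entryD4 a b =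
    entryG2 i (foldG2 b))
  delta := (by decide : ∀ i, ∑ a with foldG2 a = i, deltaD4 a = deltaG2 i)

theorem isAffineMatrix_cartan : ∀ {X : AffineType}, X.IsValid → IsAffineMatrix X.cartan X.delta
  | A _, h => affine_A h
  | B _, h => (isFolding_B h).isAffineMatrix (affine_D (Nat.succ_le_succ h))
  | C n, h => (isFolding_C h).isAffineMatrix (affine_A (by change 2 ≤ n at h; omega))
  | D _, h => affine_D h
  | E6, _ => affine_E6
  | E7, _ => affine_E7
  | E8, _ => affine_E8
  | F4, _ => isFolding_F4.isAffineMatrix affine_E6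
  | G2, _ => isFolding_G2.isAffineMatrix (affine_D le_rfl)

/-- Only the vertices `n` and `n + 1` of `D̃_{n+1}` are identified, so `0` and `1` have one-element
fibres and inherit the answer from there. -/
theorem obtains_B {n : ℕ} (hn : 3 ≤ n) {i j : Fin (n + 1)} (hi : i.val ≤ 1)
    (hj : j.val = swapD (n + 1) i) : (B n).Obtains i j := by
  have hj1 : j.val ≤ 1 := by rw [hj]; unfold swapD; split_ifs <;> omega
  have hinj : ∀ a : Fin (n + 1), a.val ≤ 1 → ∀ c : Fin (n + 1 + 1),
      foldB n c = a → c = a.castSucc := fun a ha c hc => by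
    have h1 : min c.val n = a.val := congrArg Fin.val hc
    exact Fin.ext (by rw [Fin.val_castSucc]; omega)
  have hfold : ∀ a : Fin (n + 1), foldB n a.castSucc = a := fun a =>
    Fin.ext (Nat.min_eq_left (Nat.lt_succ_iff.1 a.2))
  have h := (isFolding_B hn).obtains (a := i.castSucc) (b := j.castSucc)
    (fun c hc => hinj i hi c (hc.trans (hfold i))) (fun c hc => hinj j hj1 c (hc.trans (hfold j)))
    (obtains_D (by omega) (by rw [deltaD_apply, if_pos (Or.inl (by simpa using hi))]) hj)
  exact (congrArg₂ (B n).Obtains (hfold i) (hfold j)).mp h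

theorem obtains_C {n : ℕ} (hn : 2 ≤ n) {i j : Fin (n + 1)} (hi : i.val = 0 ∨ i.val = n)
    (hj : j.val = n - i.val) : (C n).Obtains i j := by
  let e : Fin (n + 1) → Fin (2 * n - 1 + 1) := fun a => ⟨a.val, by omega⟩
  have hinj : ∀ a : Fin (n + 1), a.val = 0 ∨ a.val = n → ∀ c : Fin (2 * n - 1 + 1),
      foldC n c = a → c = e a := fun a ha c hc => by
    have h1 : min c.val (2 * n - c.val) = a.val := congrArg Fin.val hc
    exact Fin.ext (by change c.val = a.val; omega)
  have hfold : ∀ a : Fin (n + 1), foldC n (e a) = a := fun a =>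
    Fin.ext (Nat.min_eq_left (by change a.val ≤ 2 * n - a.val; omega))
  have h := (isFolding_C hn).obtains (a := e i) (b := e j)
    (fun c hc => hinj i hi c (hc.trans (hfold i)))
    (fun c hc => hinj j (by omega) c (hc.trans (hfold j)))
    (obtains_A_odd (by omega) (by
      change j.val = (i.val + n) % (2 * n)
      rcases hi with hi | hi
      · rw [hj, hi, Nat.mod_eq_of_lt (by omega)]; omega
      · rw [hj, hi, ← two_mul, Nat.mod_self]; omega))
  exact (congrArg₂ (C n).Obtains (hfold i) (hfold j)).mp h

theorem obtains_F4 : F4.Obtains 0 0 :=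
  isFolding_F4.obtains (a := (0 : Fin 7)) (b := (0 : Fin 7))
    (by decide : ∀ c, foldF4 c = foldF4 0 → c = 0) (by decide : ∀ c, foldF4 c = foldF4 0 → c = 0)
    (obtains_E6 0 rfl)

theorem obtains_G2 : G2.Obtains 0 0 :=
  isFolding_G2.obtains (a := (0 : Fin 5)) (b := (0 : Fin 5))
    (by decide : ∀ c, foldG2 c = foldG2 0 → c = 0) (by decide : ∀ c, foldG2 c = foldG2 0 → c = 0)
    (obtains_D le_rfl rfl rfl)

end AffineType

/-! ### Uniqueness of the automorphism, and the exceptional graphs. -/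

namespace AffineType

/-- An involution `ι` that is the unique automorphism inducing the map of the extending vertices. -/
def IsUniqueIota (X : AffineType) (ι : X.graph ≃g X.graph) : Prop :=
  X.IsIota ι ∧ (∀ τ : X.graph ≃g X.graph, X.IsIota τ → τ = ι) ∧ ∀ v, ι (ι v) = v

/-- If `τ` induces the same map, then `ι ∘ τ` fixes all vertices with `δ = 1`, and rigidity makes it
trivial. -/
theorem isUniqueIota {X : AffineType} (hX : X.IsValid) (ι : X.graph ≃g X.graph)
    (hinv : ∀ v, ι (ι v) = v) (hδ : ∀ i, X.delta i = 1 → X.delta (ι i) = 1)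
    (hob : ∀ i, X.delta i = 1 → X.Obtains i (ι i))
    (hext : ∀ i, X.delta i = 1 → X.IsExtending i)
    (hrigid : ∀ τ : X.graph ≃g X.graph, (∀ i, X.delta i = 1 → τ i = i) → ∀ v, τ v = v) :
    X.IsUniqueIota ι := by
  have hone : ∀ i, X.IsExtending i → X.delta i = 1 := fun i =>
    delta_eq_one_of_isExtending (fun _ => isAffineMatrix_cartan) hX
  refine ⟨fun i hi => ⟨hext _ (hδ i (hone i hi)), hob i (hone i hi)⟩, fun τ hτ => ?_, hinv⟩
  have h1 : ∀ v, ι (τ v) = v := hrigid (τ.trans ι) fun i hi => by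
    have := Obtains.eq (isAffineMatrix_cartan hX).pos (hτ i (hext i hi)).2 (hob i hi)
    change ι (τ i) = i
    rw [this, hinv]
  ext1 v
  rw [← hinv (τ v), h1]

section Rigidity

variable {V : Type*} {G : SimpleGraph V}

/-- `τ` permutes the neighbours of the fixed vertex `k`, so it cannot move exactly one of them. -/
theorem apply_eq_of_neighbors (τ : G ≃g G) {k j : V} (hk : τ k = k) (hkj : G.Adj k j)
    (h : ∀ l, G.Adj k l → l = j ∨ τ l = l) : τ j = j := by
  have h1 : G.Adj k (τ j) := by
    have := τ.map_adj_iff.2 hkj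
    rwa [hk] at this
  rcases h _ h1 with h2 | h2
  · exact h2
  · exact τ.injective h2

theorem existsUnique_adj_apply (τ : G ≃g G) {i : V} (h : ∃! j, G.Adj i j) :
    ∃! j, G.Adj (τ i) j := by
  obtain ⟨j, hj, hu⟩ := h
  refine ⟨τ j, τ.map_adj_iff.2 hj, fun k hk => ?_⟩
  rw [← hu (τ.symm k) (τ.map_adj_iff.1 (by rwa [τ.apply_symm_apply])), τ.apply_symm_apply]

variable {N : ℕ} {Γ : SimpleGraph (Fin N)} {M : Fin N → Fin N → ℤ}

theorem apply_eq_of_mem_insert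
    (hG : ∀ i j, Γ.Adj i j ↔ i ≠ j ∧ (M i j ≠ 0 ∨ M j i ≠ 0)) (τ : Γ ≃g Γ)
    {S : Finset (Fin N)} (hS : ∀ s ∈ S, τ s = s) (k j : Fin N)
    (h : k ∈ S ∧ (k ≠ j ∧ (M k j ≠ 0 ∨ M j k ≠ 0)) ∧
      ∀ l, k ≠ l ∧ (M k l ≠ 0 ∨ M l k ≠ 0) → l = j ∨ l ∈ S) :
    ∀ s ∈ insert j S, τ s = s := fun s hs => by
  rcases Finset.mem_insert.1 hs with rfl | hs
  · exact apply_eq_of_neighbors τ (hS k h.1) ((hG k s).2 h.2.1) fun l hl =>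
      (h.2.2 l ((hG k l).1 hl)).imp_right (hS l)
  · exact hS s hs

theorem card_neighbors_apply
    (hG : ∀ i j, Γ.Adj i j ↔ i ≠ j ∧ (M i j ≠ 0 ∨ M j i ≠ 0)) (τ : Γ ≃g Γ) (i : Fin N) :
    (Finset.univ.filter fun l => τ i ≠ l ∧ (M (τ i) l ≠ 0 ∨ M l (τ i) ≠ 0)).card =
      (Finset.univ.filter fun l => i ≠ l ∧ (M i l ≠ 0 ∨ M l i ≠ 0)).card := by
  refine (Finset.card_equiv τ.toEquiv fun l => ?_).symm
  simp only [Finset.mem_filter, Finset.mem_univ, true_and, ← hG]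
  exact τ.map_adj_iff.symm

end Rigidity

section Exceptional

theorem adj_E6 (i j : Fin 7) :
    E6.graph.Adj i j ↔ i ≠ j ∧ (entryE6 i j ≠ 0 ∨ entryE6 j i ≠ 0) := graph_adj (X := E6) i j

theorem adj_E7 (i j : Fin 8) :
    E7.graph.Adj i j ↔ i ≠ j ∧ (entryE7 i j ≠ 0 ∨ entryE7 j i ≠ 0) := graph_adj (X := E7) i j

theorem adj_E8 (i j : Fin 9) :
    E8.graph.Adj i j ↔ i ≠ j ∧ (entryE8 i j ≠ 0 ∨ entryE8 j i ≠ 0) := graph_adj (X := E8) i j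

theorem adj_F4 (i j : Fin 5) :
    F4.graph.Adj i j ↔ i ≠ j ∧ (entryF4 i j ≠ 0 ∨ entryF4 j i ≠ 0) := graph_adj (X := F4) i j

theorem adj_G2 (i j : Fin 3) :
    G2.graph.Adj i j ↔ i ≠ j ∧ (entryG2 i j ≠ 0 ∨ entryG2 j i ≠ 0) := graph_adj (X := G2) i j

theorem rigid_E6 (τ : E6.graph ≃g E6.graph) (h : ∀ i : Fin 7, deltaE6 i = 1 → τ i = i)
    (v : Fin 7) : τ v = v := by
  have h0 : ∀ s ∈ ({0, 1, 6} : Finset (Fin 7)), τ s = s := fun s hs =>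
    h s ((by decide : ∀ s ∈ ({0, 1, 6} : Finset (Fin 7)), deltaE6 s = 1) s hs)
  have h1 := apply_eq_of_mem_insert adj_E6 τ h0 0 2 (by decide)
  have h2 := apply_eq_of_mem_insert adj_E6 τ h1 2 4 (by decide)
  have h3 := apply_eq_of_mem_insert adj_E6 τ h2 1 3 (by decide)
  have h4 := apply_eq_of_mem_insert adj_E6 τ h3 6 5 (by decide)
  exact h4 v ((by decide : ∀ v : Fin 7, v ∈ ({5, 3, 4, 2, 0, 1, 6} : Finset (Fin 7))) v)

/-- `4` is the only vertex of degree three, and `2` the only leaf next to it. -/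
theorem apply_E7_two (τ : E7.graph ≃g E7.graph) :
    τ (4 : Fin 8) = (4 : Fin 8) ∧ τ (2 : Fin 8) = (2 : Fin 8) := by
  have h4 : τ (4 : Fin 8) = (4 : Fin 8) :=
    (by decide : ∀ v : Fin 8, (Finset.univ.filter fun l =>
      v ≠ l ∧ (entryE7 v l ≠ 0 ∨ entryE7 l v ≠ 0)).card = (Finset.univ.filter fun l =>
      4 ≠ l ∧ (entryE7 4 l ≠ 0 ∨ entryE7 l 4 ≠ 0)).card → v = 4) _
      (card_neighbors_apply adj_E7 τ 4)
  have h2 := (adj_E7 _ _).1 (τ.map_adj_iff.2 ((adj_E7 4 2).2 (by decide)))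
  rw [h4] at h2
  exact ⟨h4, (by decide : ∀ v : Fin 8, (Finset.univ.filter fun l =>
      v ≠ l ∧ (entryE7 v l ≠ 0 ∨ entryE7 l v ≠ 0)).card = (Finset.univ.filter fun l =>
      2 ≠ l ∧ (entryE7 2 l ≠ 0 ∨ entryE7 l 2 ≠ 0)).card →
      (4 ≠ v ∧ (entryE7 4 v ≠ 0 ∨ entryE7 v 4 ≠ 0)) → v = 2) _
      (card_neighbors_apply adj_E7 τ 2) h2⟩

theorem rigid_E7 (τ : E7.graph ≃g E7.graph) (h : τ (0 : Fin 8) = (0 : Fin 8)) (v : Fin 8) :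
    τ v = v := by
  have h0 : ∀ s ∈ ({0, 2, 4} : Finset (Fin 8)), τ s = s := fun s hs => by
    rcases (by decide : ∀ s ∈ ({0, 2, 4} : Finset (Fin 8)), s = 0 ∨ s = 2 ∨ s = 4) s hs with
      rfl | rfl | rfl
    exacts [h, (apply_E7_two τ).2, (apply_E7_two τ).1]
  have h1 := apply_eq_of_mem_insert adj_E7 τ h0 0 1 (by decide)
  have h2 := apply_eq_of_mem_insert adj_E7 τ h1 1 3 (by decide)
  have h3 := apply_eq_of_mem_insert adj_E7 τ h2 4 5 (by decide)
  have h4 := apply_eq_of_mem_insert adj_E7 τ h3 5 6 (by decide)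
  have h5 := apply_eq_of_mem_insert adj_E7 τ h4 6 7 (by decide)
  exact h5 v ((by decide : ∀ v : Fin 8, v ∈ ({7, 6, 5, 3, 1, 0, 2, 4} : Finset (Fin 8))) v)

theorem apply_E7_zero (τ : E7.graph ≃g E7.graph) :
    τ (0 : Fin 8) = (0 : Fin 8) ∨ τ (0 : Fin 8) = (7 : Fin 8) := by
  refine (by decide : ∀ v : Fin 8, (Finset.univ.filter fun l =>
      v ≠ l ∧ (entryE7 v l ≠ 0 ∨ entryE7 l v ≠ 0)).card = (Finset.univ.filter fun l =>
      0 ≠ l ∧ (entryE7 0 l ≠ 0 ∨ entryE7 l 0 ≠ 0)).card → v ≠ 2 → v = 0 ∨ v = 7) _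
      (card_neighbors_apply adj_E7 τ 0) fun h2 => ?_
  have h := τ.injective (h2.trans (apply_E7_two τ).2.symm)
  exact absurd h (by decide : (0 : Fin 8) ≠ 2)

theorem rigid_E8 (τ : E8.graph ≃g E8.graph) (h : τ (0 : Fin 9) = (0 : Fin 9)) (v : Fin 9) :
    τ v = v := by
  have h0 : ∀ s ∈ ({0} : Finset (Fin 9)), τ s = s := fun s hs => by
    rw [Finset.mem_singleton.1 hs]; exact h
  have h1 := apply_eq_of_mem_insert adj_E8 τ h0 0 8 (by decide)
  have h2 := apply_eq_of_mem_insert adj_E8 τ h1 8 7 (by decide)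
  have h3 := apply_eq_of_mem_insert adj_E8 τ h2 7 6 (by decide)
  have h4 := apply_eq_of_mem_insert adj_E8 τ h3 6 5 (by decide)
  have h5 := apply_eq_of_mem_insert adj_E8 τ h4 5 4 (by decide)
  -- At the branch vertex two neighbours are still open; `2` is the one that is a leaf.
  have h6 : ∀ s ∈ insert 2 ({4, 5, 6, 7, 8, 0} : Finset (Fin 9)), τ s = s := fun s hs => by
    rcases Finset.mem_insert.1 hs with rfl | hs
    · have ha := (adj_E8 _ _).1 (τ.map_adj_iff.2 ((adj_E8 4 2).2 (by decide)))
      have h4' : τ (4 : Fin 9) = (4 : Fin 9) := h5 4 (by decide)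
      rw [h4'] at ha
      exact (by decide : ∀ v : Fin 9, (Finset.univ.filter fun l =>
        v ≠ l ∧ (entryE8 v l ≠ 0 ∨ entryE8 l v ≠ 0)).card = (Finset.univ.filter fun l =>
        2 ≠ l ∧ (entryE8 2 l ≠ 0 ∨ entryE8 l 2 ≠ 0)).card →
        (4 ≠ v ∧ (entryE8 4 v ≠ 0 ∨ entryE8 v 4 ≠ 0)) → v = 2) _
        (card_neighbors_apply adj_E8 τ 2) ha
    · exact h5 s hs
  have h7 := apply_eq_of_mem_insert adj_E8 τ h6 4 3 (by decide)
  have h8 := apply_eq_of_mem_insert adj_E8 τ h7 3 1 (by decide)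
  exact h8 v ((by decide : ∀ v : Fin 9, v ∈ ({1, 3, 2, 4, 5, 6, 7, 8, 0} : Finset (Fin 9))) v)

theorem rigid_F4 (τ : F4.graph ≃g F4.graph) (h : τ (0 : Fin 5) = (0 : Fin 5)) (v : Fin 5) :
    τ v = v := by
  have h0 : ∀ s ∈ ({0} : Finset (Fin 5)), τ s = s := fun s hs => by
    rw [Finset.mem_singleton.1 hs]; exact h
  have h1 := apply_eq_of_mem_insert adj_F4 τ h0 0 1 (by decide)
  have h2 := apply_eq_of_mem_insert adj_F4 τ h1 1 2 (by decide)
  have h3 := apply_eq_of_mem_insert adj_F4 τ h2 2 3 (by decide)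
  have h4 := apply_eq_of_mem_insert adj_F4 τ h3 3 4 (by decide)
  exact h4 v ((by decide : ∀ v : Fin 5, v ∈ ({4, 3, 2, 1, 0} : Finset (Fin 5))) v)

theorem rigid_G2 (τ : G2.graph ≃g G2.graph) (h : τ (0 : Fin 3) = (0 : Fin 3)) (v : Fin 3) :
    τ v = v := by
  have h0 : ∀ s ∈ ({0} : Finset (Fin 3)), τ s = s := fun s hs => by
    rw [Finset.mem_singleton.1 hs]; exact h
  have h1 := apply_eq_of_mem_insert adj_G2 τ h0 0 1 (by decide)
  have h2 := apply_eq_of_mem_insert adj_G2 τ h1 1 2 (by decide)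
  exact h2 v ((by decide : ∀ v : Fin 3, v ∈ ({2, 1, 0} : Finset (Fin 3))) v)

theorem isUniqueIota_E6 : E6.IsUniqueIota SimpleGraph.Iso.refl := by
  refine isUniqueIota (X := E6) trivial _ (fun _ => rfl) (fun _ h => h) obtains_E6 ?_ rigid_E6
  -- The rotation of the three arms, `0 ↦ 1 ↦ 6 ↦ 0` on the leaves.
  have hrot : ∀ i j : Fin 7, entryE6 ((![1, 6, 3, 5, 4, 2, 0] : Fin 7 → Fin 7) i)
    ((![1, 6, 3, 5, 4, 2, 0] : Fin 7 → Fin 7) j) = entryE6 i j := by decide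
  let σ : Fin 7 ≃ Fin 7 := ⟨![1, 6, 3, 5, 4, 2, 0], ![6, 0, 5, 2, 4, 3, 1], by decide, by decide⟩
  have h0 : E6.IsExtending (0 : Fin 7) := isExtending_zero trivial
  have h6 : E6.IsExtending (6 : Fin 7) := IsExtending.of_apply (X := E6) (σ := σ) hrot h0
  have h1 : E6.IsExtending (1 : Fin 7) := IsExtending.of_apply (X := E6) (σ := σ) hrot h6
  intro i hi
  rcases (by decide : ∀ i : Fin 7, deltaE6 i = 1 → i = 0 ∨ i = 1 ∨ i = 6) i hi with
    rfl | rfl | rfl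
  exacts [h0, h1, h6]

/-- The flip of `Ẽ_7`. -/
def flipE7 : Fin 8 ≃ Fin 8 :=
  ⟨![7, 6, 2, 5, 4, 3, 1, 0], ![7, 6, 2, 5, 4, 3, 1, 0], by decide, by decide⟩

theorem entryE7_flip : ∀ i j : Fin 8, entryE7 (flipE7 i) (flipE7 j) = entryE7 i j := by decide

/-- The nontrivial automorphism of `Ẽ_7`. -/
def iotaE7 : E7.graph ≃g E7.graph := graphAut (X := E7) flipE7 entryE7_flip

theorem isUniqueIota_E7 : E7.IsUniqueIota iotaE7 := by
  refine isUniqueIota (X := E7) trivial _ (by decide : ∀ v, flipE7 (flipE7 v) = v)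
    (by decide : ∀ i, deltaE7 i = 1 → deltaE7 (flipE7 i) = 1) obtains_E7 ?_
    (fun τ h => rigid_E7 τ (h _ rfl))
  have h0 : E7.IsExtending (0 : Fin 8) := isExtending_zero trivial
  have h7 : E7.IsExtending (7 : Fin 8) := IsExtending.of_apply (X := E7) (σ := flipE7)
    entryE7_flip h0
  intro i hi
  rcases (by decide : ∀ i : Fin 8, deltaE7 i = 1 → i = 0 ∨ i = 7) i hi with rfl | rfl
  exacts [h0, h7]

theorem eq_iotaE7 {τ : E7.graph ≃g E7.graph} (hτ : τ ≠ SimpleGraph.Iso.refl) : τ = iotaE7 := by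
  rcases apply_E7_zero τ with h | h
  · exact absurd (RelIso.ext (rigid_E7 τ h)) hτ
  · have h1 := rigid_E7 (τ.trans iotaE7) (by
      change iotaE7 (τ (0 : Fin 8)) = (0 : Fin 8)
      rw [h]; rfl)
    ext1 v
    rw [← isUniqueIota_E7.2.2 (τ v)]
    exact congrArg iotaE7 (h1 v)

theorem isUniqueIota_E8 : E8.IsUniqueIota SimpleGraph.Iso.refl := by
  have h0 : ∀ i : Fin 9, deltaE8 i = 1 → i = 0 := by decide
  refine isUniqueIota (X := E8) trivial _ (fun _ => rfl) (fun _ h => h) obtains_E8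
    (fun i hi => ?_) (fun τ h => rigid_E8 τ (h _ rfl))
  rw [h0 i hi]
  exact isExtending_zero (X := E8) trivial

theorem isUniqueIota_F4 : F4.IsUniqueIota SimpleGraph.Iso.refl := by
  have h0 : ∀ i : Fin 5, deltaF4 i = 1 → i = 0 := by decide
  refine isUniqueIota (X := F4) trivial _ (fun _ => rfl) (fun _ h => h) (fun i hi => ?_)
    (fun i hi => ?_) (fun τ h => rigid_F4 τ (h _ rfl))
  · obtain rfl := h0 i hi
    exact obtains_F4
  · obtain rfl := h0 i hi
    exact isExtending_zero (X := F4) trivial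

theorem isUniqueIota_G2 : G2.IsUniqueIota SimpleGraph.Iso.refl := by
  have h0 : ∀ i : Fin 3, deltaG2 i = 1 → i = 0 := by decide
  refine isUniqueIota (X := G2) trivial _ (fun _ => rfl) (fun _ h => h) (fun i hi => ?_)
    (fun i hi => ?_) (fun τ h => rigid_G2 τ (h _ rfl))
  · obtain rfl := h0 i hi
    exact obtains_G2
  · obtain rfl := h0 i hi
    exact isExtending_zero (X := G2) trivial

end Exceptional

end AffineType

/-! ### The automorphisms for the infinite series. -/

namespace AffineType

theorem matrixA_add (n : ℕ) (s i j : Fin (n + 1)) :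
    matrixA n (i + s) (j + s) = matrixA n i j := by
  simp only [matrixA_apply, add_right_comm _ s 1, add_left_inj]

theorem isExtending_A {n : ℕ} (hn : 1 ≤ n) (i : Fin (n + 1)) : (A n).IsExtending i :=
  IsExtending.of_apply (X := A n) (σ := Equiv.addRight (-i)) (matrixA_add n (-i))
    ((congrArg (A n).IsExtending (add_neg_cancel i)).mpr (isExtending_zero hn))

theorem isUniqueIota_A_even {m : ℕ} (hm : 1 ≤ m) :
    (A (2 * m)).IsUniqueIota SimpleGraph.Iso.refl := by
  have hX : (A (2 * m)).IsValid := by change 1 ≤ 2 * m; omega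
  exact isUniqueIota hX _ (fun _ => rfl) (fun _ h => h) (fun i _ => obtains_A_even hm i)
    (fun i _ => isExtending_A hX i) (fun τ h v => h v rfl)

theorem exists_isUniqueIota_A_odd {m : ℕ} (hm : 1 ≤ m) :
    ∃ ι : (A (2 * m - 1)).graph ≃g (A (2 * m - 1)).graph, (A (2 * m - 1)).IsUniqueIota ι ∧
      ∀ v, (ι v : ℕ) = ((v : ℕ) + m) % (2 * m) := by
  have hX : (A (2 * m - 1)).IsValid := by change 1 ≤ 2 * m - 1; omega
  have hN : 2 * m - 1 + 1 = 2 * m := by omega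
  let s : Fin (2 * m - 1 + 1) := ⟨m, by omega⟩
  have hval : ∀ i : Fin (2 * m - 1 + 1), (i + s).val = (i.val + m) % (2 * m) := fun i => by
    exact (Fin.val_add i s).trans (congrArg (fun N => (i.val + m) % N) hN)
  refine ⟨graphAut (X := A (2 * m - 1)) (Equiv.addRight s) (matrixA_add _ s), isUniqueIota hX _
    (fun v => ?_) (fun _ h => h) (fun i _ => obtains_A_odd hm (hval i))
    (fun i _ => isExtending_A hX i) (fun τ h v => h v rfl), hval⟩
  have hs : s + s = 0 := Fin.ext (by rw [hval]; simp [s, ← two_mul])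
  exact (add_assoc (v : Fin (2 * m - 1 + 1)) s s).trans
    ((congrArg (fun t => (v : Fin (2 * m - 1 + 1)) + t) hs).trans (add_zero _))

/-- Adjacency of `B̃_n`, for numbers as vertices. -/
theorem adj_B {n : ℕ} (hn : 3 ≤ n) (i j : Fin (n + 1)) : (B n).graph.Adj i j ↔
    (1 ≤ i.val ∧ i.val + 1 = j.val) ∨ (1 ≤ j.val ∧ j.val + 1 = i.val) ∨
      (i.val = 0 ∧ j.val = 2) ∨ (j.val = 0 ∧ i.val = 2) := by
  refine (graph_adj (X := B n) i j).trans ?_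
  have h1 : (B n).cartan i j = entryB n i.val j.val := cartan_B n i j
  have h2 : (B n).cartan j i = entryB n j.val i.val := cartan_B n j i
  have h3 : i ≠ j ↔ i.val ≠ j.val := Fin.ext_iff.not
  refine Iff.trans (and_congr h3 (or_congr (not_congr (Eq.congr_left h1))
    (not_congr (Eq.congr_left h2)))) ?_
  unfold entryB
  grind (splits := 25)

theorem adj_C {n : ℕ} (i j : Fin (n + 1)) : (C n).graph.Adj i j ↔
    i.val + 1 = j.val ∨ j.val + 1 = i.val := by
  refine (graph_adj (X := C n) i j).trans ?_
  have h1 : (C n).cartan i j = entryC n i.val j.val := cartan_C n i j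
  have h2 : (C n).cartan j i = entryC n j.val i.val := cartan_C n j i
  have h3 : i ≠ j ↔ i.val ≠ j.val := Fin.ext_iff.not
  refine Iff.trans (and_congr h3 (or_congr (not_congr (Eq.congr_left h1))
    (not_congr (Eq.congr_left h2)))) ?_
  unfold entryC
  grind (splits := 25)

theorem adj_D {n : ℕ} (hn : 4 ≤ n) (i j : Fin (n + 1)) : (D n).graph.Adj i j ↔
    (i.val = 0 ∧ j.val = 2) ∨ (j.val = 0 ∧ i.val = 2) ∨
      (i.val + 2 = n ∧ j.val = n) ∨ (j.val + 2 = n ∧ i.val = n) ∨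
      (1 ≤ i.val ∧ i.val + 1 = j.val ∧ j.val + 1 ≤ n) ∨
      (1 ≤ j.val ∧ j.val + 1 = i.val ∧ i.val + 1 ≤ n) := by
  refine (graph_adj (X := D n) i j).trans ?_
  have h1 : (D n).cartan i j = entryD n i.val j.val := matrixD_apply n i j
  have h2 : (D n).cartan j i = entryD n j.val i.val := matrixD_apply n j i
  have h3 : i ≠ j ↔ i.val ≠ j.val := Fin.ext_iff.not
  refine Iff.trans (and_congr h3 (or_congr (not_congr (Eq.congr_left h1))
    (not_congr (Eq.congr_left h2)))) ?_
  rw [entryD_comm n j i, or_self]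
  unfold entryD
  grind (splits := 25)

/-- An automorphism is trivial if each vertex outside a set of fixed vertices is the only
neighbour with a larger number of some vertex with a smaller number. -/
theorem apply_eq_of_forall_lt {N : ℕ} {G : SimpleGraph (Fin N)} (τ : G ≃g G)
    (h : ∀ v, τ v = v ∨ ∃ u < v, G.Adj u v ∧ ∀ l, G.Adj u l → l = v ∨ l < v ∨ τ l = l)
    (v : Fin N) : τ v = v := by
  induction v using WellFoundedLT.induction with
  | _ v ih =>
    rcases h v with h1 | ⟨u, hu, huv, hl⟩
    · exact h1
    · exact apply_eq_of_neighbors τ (ih u hu) huv fun l hul => by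
        rcases hl l hul with h1 | h1 | h1
        exacts [.inl h1, .inr (ih l h1), .inr h1]

theorem rigid_B {n : ℕ} (hn : 3 ≤ n) (τ : (B n).graph ≃g (B n).graph)
    (h : ∀ i : Fin (n + 1), i.val ≤ 1 → τ i = i) (v : Fin (n + 1)) : τ v = v := by
  refine apply_eq_of_forall_lt (N := n + 1) τ (fun v => ?_) v
  by_cases hv : v.val ≤ 1
  · exact .inl (h v hv)
  · refine .inr ⟨⟨v.val - 1, by omega⟩, Fin.lt_def.2 (by dsimp only; omega),
      (adj_B hn _ _).2 (by dsimp only; omega), fun l hl => ?_⟩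
    have := (adj_B hn _ _).1 hl
    rw [Fin.ext_iff, Fin.lt_def]
    dsimp only at this
    omega

theorem rigid_C {n : ℕ} (τ : (C n).graph ≃g (C n).graph)
    (h : τ (0 : Fin (n + 1)) = (0 : Fin (n + 1))) (v : Fin (n + 1)) : τ v = v := by
  refine apply_eq_of_forall_lt (N := n + 1) τ (fun v => ?_) v
  by_cases hv : v = 0
  · exact .inl (hv ▸ h)
  · have hv' := Fin.val_ne_zero_iff.2 hv
    refine .inr ⟨⟨v.val - 1, by omega⟩, Fin.lt_def.2 (by dsimp only; omega),
      (adj_C _ _).2 (by dsimp only; omega), fun l hl => ?_⟩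
    have := (adj_C _ _).1 hl
    rw [Fin.ext_iff, Fin.lt_def]
    dsimp only at this
    omega

theorem rigid_D {n : ℕ} (hn : 4 ≤ n) (τ : (D n).graph ≃g (D n).graph)
    (h : ∀ i : Fin (n + 1), i.val ≤ 1 ∨ n ≤ i.val + 1 → τ i = i) (v : Fin (n + 1)) :
    τ v = v := by
  refine apply_eq_of_forall_lt (N := n + 1) τ (fun v => ?_) v
  by_cases hv : v.val ≤ 1 ∨ n ≤ v.val + 1
  · exact .inl (h v hv)
  · refine .inr ⟨⟨v.val - 1, by omega⟩, Fin.lt_def.2 (by dsimp only; omega),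
      (adj_D hn _ _).2 (by dsimp only; omega), fun l hl => ?_⟩
    have := (adj_D hn _ _).1 hl
    rw [Fin.ext_iff, Fin.lt_def]
    dsimp only at this
    omega

/-- The permutation of the vertices of `B̃_n` that is induced by the strategy. -/
def swapB (n a : ℕ) : ℕ :=
  if (n + 1) % 4 ≤ 1 then a else if a = 0 then 1 else if a = 1 then 0 else a

/-- The exchange of the vertices `0` and `1` of `B̃_n` and `D̃_n`. -/
def exchange (a : ℕ) : ℕ := if a = 0 then 1 else if a = 1 then 0 else a

/-- The permutation of `0, …, n` given by an involution of the natural numbers. -/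
def permOfInvolution (n : ℕ) (f : ℕ → ℕ) (hf : ∀ a ≤ n, f a ≤ n ∧ f (f a) = a) :
    Fin (n + 1) ≃ Fin (n + 1) where
  toFun i := ⟨f i, Nat.lt_succ_iff.2 (hf i (Nat.lt_succ_iff.1 i.2)).1⟩
  invFun i := ⟨f i, Nat.lt_succ_iff.2 (hf i (Nat.lt_succ_iff.1 i.2)).1⟩
  left_inv i := Fin.ext (hf i (Nat.lt_succ_iff.1 i.2)).2
  right_inv i := Fin.ext (hf i (Nat.lt_succ_iff.1 i.2)).2

theorem exists_isUniqueIota_B {n : ℕ} (hn : 3 ≤ n) :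
    ∃ ι : (B n).graph ≃g (B n).graph, (B n).IsUniqueIota ι ∧
      ∀ v, (ι v : ℕ) = swapB n v := by
  have hX : (B n).IsValid := hn
  have hδ : ∀ i : Fin (n + 1), (B n).delta i = 1 → i.val ≤ 1 := fun i hi => by
    have h1 : (if i.val ≤ 1 then (1 : ℤ) else 2) = 1 := hi
    by_contra h; rw [if_neg h] at h1; omega
  have hδ' : ∀ i : Fin (n + 1), i.val ≤ 1 → (B n).delta i = 1 := fun i hi =>
    if_pos (c := i.val ≤ 1) hi
  let σ := permOfInvolution n (swapB n) fun a ha => by unfold swapB; grind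
  have hσ : ∀ i j, (B n).cartan (σ i) (σ j) = (B n).cartan i j := fun i j => by
    refine (cartan_B n _ _).trans (Eq.trans ?_ (cartan_B n _ _).symm)
    change entryB n (swapB n i.val) (swapB n j.val) = _
    unfold entryB swapB
    grind (splits := 40)
  let ε := permOfInvolution n exchange fun a ha => by unfold exchange; grind
  have hε : ∀ i j, (B n).cartan (ε i) (ε j) = (B n).cartan i j := fun i j => by
    refine (cartan_B n _ _).trans (Eq.trans ?_ (cartan_B n _ _).symm)
    change entryB n (exchange i.val) (exchange j.val) = _
    unfold entryB exchange
    grind (splits := 40)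
  refine ⟨graphAut (X := B n) σ hσ, isUniqueIota hX _ σ.left_inv (fun i hi => hδ' _ ?_)
    (fun i hi => obtains_B hn (hδ i hi) ?_) (fun i hi => ?_)
    (fun τ h => rigid_B hn τ fun i hi => h i (hδ' i hi)), fun _ => rfl⟩
  · have := hδ i hi
    change swapB n i.val ≤ 1
    unfold swapB
    split_ifs <;> omega
  · have := hδ i hi
    change swapB n i.val = swapD (n + 1) i.val
    unfold swapB swapD
    split_ifs <;> omega
  · have h0 : (B n).IsExtending (0 : Fin (n + 1)) := isExtending_zero hX
    have hi' := hδ i hi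
    by_cases hi0 : i.val = 0
    · exact (congrArg (B n).IsExtending (Fin.ext hi0 : i = (0 : Fin (n + 1)))).mpr h0
    · refine IsExtending.of_apply (X := B n) hε ((congrArg (B n).IsExtending
        (Fin.ext ?_ : ε i = (0 : Fin (n + 1)))).mpr h0)
      change exchange i.val = 0
      unfold exchange
      split_ifs <;> omega

theorem exists_isUniqueIota_C {n : ℕ} (hn : 2 ≤ n) :
    ∃ ι : (C n).graph ≃g (C n).graph, (C n).IsUniqueIota ι ∧
      ∀ v, (ι v : ℕ) = n - v := by
  have hX : (C n).IsValid := hn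
  have hδ : ∀ i : Fin (n + 1), (C n).delta i = 1 → i.val = 0 ∨ i.val = n := fun i hi => by
    have h1 : (if i.val = 0 ∨ i.val = n then (1 : ℤ) else 2) = 1 := hi
    by_contra h; rw [if_neg h] at h1; omega
  have hδ' : ∀ i : Fin (n + 1), i.val = 0 ∨ i.val = n → (C n).delta i = 1 := fun i hi =>
    if_pos (c := i.val = 0 ∨ i.val = n) hi
  let σ := permOfInvolution n (fun a => n - a) fun a ha => by omega
  have hσ : ∀ i j, (C n).cartan (σ i) (σ j) = (C n).cartan i j := fun i j => by
    refine (cartan_C n _ _).trans (Eq.trans ?_ (cartan_C n _ _).symm)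
    change entryC n (n - i.val) (n - j.val) = _
    have hi : i.val < n + 1 := i.2
    have hj : j.val < n + 1 := j.2
    unfold entryC
    grind (splits := 40)
  refine ⟨graphAut (X := C n) σ hσ, isUniqueIota hX _ σ.left_inv (fun i hi => hδ' _ ?_)
    (fun i hi => obtains_C hn (hδ i hi) rfl) (fun i hi => ?_)
    (fun τ h => rigid_C τ (h (0 : Fin (n + 1)) (hδ' 0 (.inl rfl)))), fun _ => rfl⟩
  · have := hδ i hi
    change n - i.val = 0 ∨ n - i.val = n
    omega
  · have h0 : (C n).IsExtending (0 : Fin (n + 1)) := isExtending_zero hX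
    rcases hδ i hi with hi0 | hi0
    · exact (congrArg (C n).IsExtending (Fin.ext hi0 : i = (0 : Fin (n + 1)))).mpr h0
    · refine IsExtending.of_apply (X := C n) hσ ((congrArg (C n).IsExtending
        (Fin.ext ?_ : σ i = (0 : Fin (n + 1)))).mpr h0)
      change n - i.val = 0
      omega

theorem entryD_exchange {n : ℕ} (hn : 4 ≤ n) (a b : ℕ) :
    entryD n (exchange a) (exchange b) = entryD n a b := by
  unfold entryD exchange
  grind (splits := 40)

theorem entryD_sub {n a b : ℕ} (hn : 4 ≤ n) (ha : a ≤ n) (hb : b ≤ n) :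
    entryD n (n - a) (n - b) = entryD n a b := by
  unfold entryD
  grind (splits := 40)

/-- The exchange at the far end is the one at the near end conjugated by the flip `a ↦ n - a`.
Invariance of the matrix then reduces to that under `exchange` and the flip. -/
theorem swapD_eq {n a : ℕ} (hn : 4 ≤ n) (h : 2 ≤ n % 4) (ha : a ≤ n) :
    swapD n a = exchange (n - exchange (n - a)) := by
  unfold swapD exchange
  grind

theorem exchange_le {n a : ℕ} (hn : 1 ≤ n) (ha : a ≤ n) : exchange a ≤ n := by
  unfold exchange
  grind

theorem entryD_swapD {n a b : ℕ} (hn : 4 ≤ n) (ha : a ≤ n) (hb : b ≤ n) :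
    entryD n (swapD n a) (swapD n b) = entryD n a b := by
  by_cases h : 2 ≤ n % 4
  · rw [swapD_eq hn h ha, swapD_eq hn h hb, entryD_exchange hn,
      entryD_sub hn (exchange_le (by omega) (by omega)) (exchange_le (by omega) (by omega)),
      entryD_exchange hn, entryD_sub hn ha hb]
  · have h1 : ∀ c, swapD n c = c := fun c => if_pos (by omega)
    rw [h1, h1]

theorem exists_isUniqueIota_D {n : ℕ} (hn : 4 ≤ n) :
    ∃ ι : (D n).graph ≃g (D n).graph, (D n).IsUniqueIota ι ∧
      ∀ v, (ι v : ℕ) = swapD n v := by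
  have hX : (D n).IsValid := hn
  have hδ : ∀ i : Fin (n + 1), (D n).delta i = 1 → i.val ≤ 1 ∨ n ≤ i.val + 1 := fun i hi => by
    have h1 : (if i.val ≤ 1 ∨ n ≤ i.val + 1 then (1 : ℤ) else 2) = 1 := hi
    by_contra h; rw [if_neg h] at h1; omega
  have hδ' : ∀ i : Fin (n + 1), i.val ≤ 1 ∨ n ≤ i.val + 1 → (D n).delta i = 1 := fun i hi =>
    if_pos (c := i.val ≤ 1 ∨ n ≤ i.val + 1) hi
  let σ := permOfInvolution n (swapD n) fun a ha => by unfold swapD; grind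
  have hσ : ∀ i j, (D n).cartan (σ i) (σ j) = (D n).cartan i j := fun i j => by
    refine (matrixD_apply n _ _).trans (Eq.trans ?_ (matrixD_apply n _ _).symm)
    exact entryD_swapD hn (Nat.lt_succ_iff.1 i.2) (Nat.lt_succ_iff.1 j.2)
  let ε := permOfInvolution n exchange fun a ha => by unfold exchange; grind
  have hε : ∀ i j, (D n).cartan (ε i) (ε j) = (D n).cartan i j := fun i j => by
    refine (matrixD_apply n _ _).trans (Eq.trans ?_ (matrixD_apply n _ _).symm)
    exact entryD_exchange hn i.val j.val
  let φ := permOfInvolution n (fun a => n - a) fun a ha => by omega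
  have hφ : ∀ i j, (D n).cartan (φ i) (φ j) = (D n).cartan i j := fun i j => by
    refine (matrixD_apply n _ _).trans (Eq.trans ?_ (matrixD_apply n _ _).symm)
    exact entryD_sub hn (Nat.lt_succ_iff.1 i.2) (Nat.lt_succ_iff.1 j.2)
  refine ⟨graphAut (X := D n) σ hσ, isUniqueIota hX _ σ.left_inv (fun i hi => hδ' _ ?_)
    (fun i hi => obtains_D hn hi rfl) (fun i hi => ?_)
    (fun τ h => rigid_D hn τ fun i hi => h i (hδ' i hi)), fun _ => rfl⟩
  · have := hδ i hi
    change swapD n i.val ≤ 1 ∨ n ≤ swapD n i.val + 1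
    unfold swapD
    split_ifs <;> omega
  · have h0 : ∀ i : Fin (n + 1), i.val = 0 → (D n).IsExtending i := fun i hi =>
      (congrArg (D n).IsExtending (Fin.ext hi : i = (0 : Fin (n + 1)))).mpr (isExtending_zero hX)
    have h1 : ∀ i : Fin (n + 1), i.val ≤ 1 → (D n).IsExtending i := fun i hi => by
      by_cases hi0 : i.val = 0
      · exact h0 i hi0
      · refine IsExtending.of_apply (X := D n) hε (h0 (ε i) ?_)
        change exchange i.val = 0
        unfold exchange
        split_ifs <;> omega
    rcases hδ i hi with h2 | h2
    · exact h1 i h2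
    · refine IsExtending.of_apply (X := D n) hφ (h1 (φ i) ?_)
      change n - i.val ≤ 1
      omega

end AffineType

/-! ### Nontrivial automorphisms of `B̃_n` and `C̃_n`, and exterior vertices of `D̃_n`. -/

namespace AffineType

theorem eq_of_forall_apply_apply {V : Type*} {G : SimpleGraph V} {ι τ : G ≃g G}
    (hι : ∀ v, ι (ι v) = v) (h : ∀ v, ι (τ v) = v) : τ = ι := by
  ext1 v
  rw [← hι (τ v), h]

theorem apply_le_one_B {n : ℕ} (hn : 4 ≤ n) (τ : (B n).graph ≃g (B n).graph) (i : Fin (n + 1))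
    (hi : i.val ≤ 1) : (τ i).val ≤ 1 := by
  have hadj := adj_B (n := n) (by omega)
  let t : Fin (n + 1) → Fin (n + 1) := τ
  have htadj : ∀ a b, (B n).graph.Adj (t a) (t b) ↔ (B n).graph.Adj a b := fun a b =>
    τ.map_adj_iff
  have hext : ∀ v : Fin (n + 1), (∃! j : Fin (n + 1), (B n).graph.Adj v j) →
      v.val ≤ 1 ∨ v.val = n := fun v ⟨j, _, hj⟩ => by
    by_contra hv
    have h1 := hj ⟨v.val - 1, by omega⟩ ((hadj _ _).2 (by dsimp only; omega))
    have h2 := hj ⟨v.val + 1, by omega⟩ ((hadj _ _).2 (by dsimp only; omega))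
    have h3 := congrArg Fin.val (h1.trans h2.symm)
    dsimp only at h3
    omega
  have hleaf : ∀ v : Fin (n + 1), v.val ≤ 1 → ∃! j : Fin (n + 1), (B n).graph.Adj v j :=
    fun v hv => ⟨⟨2, by omega⟩, (hadj _ _).2 (by dsimp only; omega), fun k hk => by
      have := (hadj _ _).1 hk
      exact Fin.ext (by dsimp only; omega)⟩
  let z : Fin (n + 1) := ⟨0, by omega⟩
  let o : Fin (n + 1) := ⟨1, by omega⟩
  let c : Fin (n + 1) := ⟨2, by omega⟩
  have h0 := hext (t z) (existsUnique_adj_apply τ (hleaf z (by simp [z])))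
  have h1 := hext (t o) (existsUnique_adj_apply τ (hleaf o (by simp [o])))
  have h0c := (hadj _ _).1 ((htadj z c).2 ((hadj z c).2 (by dsimp only [z, c]; omega)))
  have h1c := (hadj _ _).1 ((htadj o c).2 ((hadj o c).2 (by dsimp only [o, c]; omega)))
  have h01 : (t z).val ≠ (t o).val := fun h => by
    have := congrArg Fin.val (τ.injective (Fin.ext h))
    dsimp only [z, o] at this
    omega
  -- The images are leaves with a common neighbour, whereas the neighbour `n - 1` of the leaf `n`
  -- differs from `2`, as `n ≥ 4`.
  have hz : (t z).val ≤ 1 ∧ (t o).val ≤ 1 := by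
    have := (t c).2
    omega
  have hzo : i = z ∨ i = o := by
    simp only [Fin.ext_iff, z, o]
    omega
  rcases hzo with h | h
  · exact (congrArg (fun a => (t a).val) h).trans_le hz.1
  · exact (congrArg (fun a => (t a).val) h).trans_le hz.2

theorem ne_refl_iff_B {n : ℕ} (hn : 4 ≤ n) {ι : (B n).graph ≃g (B n).graph}
    (hι : ∀ v, ι (ι v) = v) (hval : ∀ v, (ι v : ℕ) = exchange v) (τ : (B n).graph ≃g (B n).graph) :
    τ ≠ SimpleGraph.Iso.refl ↔ τ = ι := by
  have hτ := apply_le_one_B hn τ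
  let z : Fin (n + 1) := ⟨0, by omega⟩
  let o : Fin (n + 1) := ⟨1, by omega⟩
  have h0 : (τ z).val ≤ 1 := hτ z (by simp [z])
  have h1 : (τ o).val ≤ 1 := hτ o (by simp [o])
  have h01 : (τ z).val ≠ (τ o).val := fun h => by
    have := congrArg Fin.val (τ.injective (Fin.ext h))
    dsimp only [z, o] at this
    omega
  have hcases : ∀ i : Fin (n + 1), i.val ≤ 1 → i = z ∨ i = o := fun i hi => by
    simp only [Fin.ext_iff, z, o]
    omega
  constructor
  · intro hne
    rcases hcases (τ z) h0 with h2 | h2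
    · refine absurd (RelIso.ext (rigid_B (by omega) τ fun i hi => ?_)) hne
      rcases hcases i hi with rfl | rfl
      · exact h2
      · refine (hcases (τ o) h1).resolve_left fun h => h01 ?_
        rw [h2, h]
    · have h3 : τ o = z := (hcases (τ o) h1).resolve_right fun h => h01 (by rw [h2, h])
      refine eq_of_forall_apply_apply hι (rigid_B (by omega) (τ.trans ι) fun i hi => ?_)
      have hz : ι o = z := Fin.ext (hval o)
      have ho : ι z = o := Fin.ext (hval z)
      rcases hcases i hi with rfl | rfl
      · exact (congrArg ι h2).trans hz
      · exact (congrArg ι h3).trans ho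
  · rintro rfl h
    have h2 := hval z
    rw [h] at h2
    exact absurd h2 (by decide : 0 ≠ exchange 0)

theorem ne_refl_iff_C {n : ℕ} (hn : 2 ≤ n) {ι : (C n).graph ≃g (C n).graph}
    (hι : ∀ v, ι (ι v) = v) (hval : ∀ v, (ι v : ℕ) = n - v) (τ : (C n).graph ≃g (C n).graph) :
    τ ≠ SimpleGraph.Iso.refl ↔ τ = ι := by
  have hadj := adj_C (n := n)
  have hext : ∀ v : Fin (n + 1), (∃! j : Fin (n + 1), (C n).graph.Adj v j) →
      v.val = 0 ∨ v.val = n := fun v ⟨j, _, hj⟩ => by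
    by_contra hv
    have h1 := hj ⟨v.val - 1, by omega⟩ ((hadj _ _).2 (by dsimp only; omega))
    have h2 := hj ⟨v.val + 1, by omega⟩ ((hadj _ _).2 (by dsimp only; omega))
    have h3 := congrArg Fin.val (h1.trans h2.symm)
    dsimp only at h3
    omega
  have hleaf : ∃! j : Fin (n + 1), (C n).graph.Adj (0 : Fin (n + 1)) j :=
    ⟨⟨1, by omega⟩, (hadj _ _).2 (by simp), fun k hk => by
      have := (hadj _ _).1 hk
      rw [Fin.val_zero] at this
      exact Fin.ext (by dsimp only; omega)⟩
  constructor
  · intro hne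
    rcases hext _ (existsUnique_adj_apply τ hleaf) with h | h
    · exact absurd (RelIso.ext (rigid_C τ (Fin.ext h))) hne
    · refine eq_of_forall_apply_apply hι (rigid_C (τ.trans ι) (Fin.ext ?_))
      refine (hval (τ (0 : Fin (n + 1)))).trans ?_
      change n - (τ (0 : Fin (n + 1))).val = 0
      omega
  · rintro rfl h
    have h2 := hval (0 : Fin (n + 1))
    rw [h] at h2
    change 0 = n - 0 at h2
    omega

theorem isExterior_D_iff {n : ℕ} (hn : 5 ≤ n) (v : Fin (n + 1)) :
    (D n).IsExterior v ↔ v.val ≤ 1 ∨ n ≤ v.val + 1 := by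
  have hadj := adj_D (n := n) (by omega)
  constructor
  · rintro ⟨j, _, hj⟩
    by_contra hv
    have h1 := hj (⟨v.val - 1, by omega⟩ : Fin (n + 1)) ((hadj _ _).2 (by dsimp only; omega))
    have h2 := hj (⟨v.val + 1, by omega⟩ : Fin (n + 1)) ((hadj _ _).2 (by dsimp only; omega))
    have h3 := congrArg Fin.val (h1.trans h2.symm)
    dsimp only at h3
    omega
  · intro hv
    have hlt := v.2
    refine ⟨(⟨if v.val ≤ 1 then 2 else n - 2, by split_ifs <;> omega⟩ : Fin (n + 1)),
      (hadj _ _).2 (by dsimp only; split_ifs <;> omega), fun k hk => Fin.ext ?_⟩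
    have := (hadj _ _).1 hk
    have hk' : k.val < n + 1 := k.2
    change k.val = if v.val ≤ 1 then 2 else n - 2
    split_ifs <;> omega

theorem swapD_of_common_neighbor {n : ℕ} (hn : 6 ≤ n) (h : 2 ≤ n % 4) {i j k : Fin (n + 1)}
    (hi : (D n).IsExterior i) (hj : (D n).IsExterior j) (hij : i ≠ j)
    (hik : (D n).graph.Adj i k) (hjk : (D n).graph.Adj j k) : swapD n i = j := by
  have hi' := (isExterior_D_iff (by omega) i).1 hi
  have hj' := (isExterior_D_iff (by omega) j).1 hj
  have hik' := (adj_D (by omega) i k).1 hik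
  have hjk' := (adj_D (by omega) j k).1 hjk
  have hij' := Fin.val_ne_of_ne hij
  have := i.2
  have := j.2
  unfold swapD
  split_ifs <;> omega

end AffineType

theorem proposition3p5 (X : AffineType) (hX : X.IsValid) :
    ∃ ι : X.graph ≃g X.graph,
      X.IsIota ι ∧ (∀ τ : X.graph ≃g X.graph, X.IsIota τ → τ = ι) ∧ (∀ v, ι (ι v) = v) ∧
      -- the types for which the involution is trivial
      ((∀ v, ι v = v) ↔
        (∃ m : ℕ, 1 ≤ m ∧
          (X = .A (2 * m) ∨ X = .B (4 * m - 1) ∨ X = .B (4 * m) ∨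
            X = .D (4 * m) ∨ X = .D (4 * m + 1))) ∨
        X = .E6 ∨ X = .E8 ∨ X = .F4 ∨ X = .G2) ∧
      -- on the cycle with `2 m` vertices it is the antipodal map
      (∀ m : ℕ, 1 ≤ m → X = .A (2 * m - 1) → ∀ v, (ι v : ℕ) = ((v : ℕ) + m) % (2 * m)) ∧
      -- it interchanges paired exterior vertices, and fixes the interior vertices
      (∀ m : ℕ, 1 ≤ m → (X = .D (4 * m + 2) ∨ X = .D (4 * m + 3)) →
        (∀ i j k, X.IsExterior i → X.IsExterior j → i ≠ j → ¬ X.IsExterior k →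
          X.graph.Adj i k → X.graph.Adj j k → ι i = j) ∧
        (∀ i, ¬ X.IsExterior i → ι i = i)) ∧
      -- it is the only automorphism of the graph besides the identity
      (((∃ m : ℕ, 1 ≤ m ∧
          (X = .B (4 * m + 1) ∨ X = .B (4 * m + 2) ∨ X = .C (m + 1))) ∨ X = .E7) →
        ∀ τ : X.graph ≃g X.graph, τ ≠ SimpleGraph.Iso.refl ↔ τ = ι) := by
  open AffineType in
  cases X with
  | A n =>
    have hn : 1 ≤ n := hX
    rcases Nat.even_or_odd' n with ⟨m, rfl | rfl⟩
    · obtain ⟨h1, h2, h3⟩ := isUniqueIota_A_even (m := m) (by omega)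
      refine ⟨_, h1, h2, h3, iff_of_true (fun _ => rfl) (.inl ⟨m, by omega, .inl rfl⟩), ?_, ?_, ?_⟩
      · intro k hk h
        have := A.inj h
        omega
      · simp
      · simp
    · obtain ⟨ι, ⟨h1, h2, h3⟩, hval⟩ := exists_isUniqueIota_A_odd (m := m + 1) (by omega)
      refine ⟨ι, h1, h2, h3, iff_of_false (fun h => ?_) ?_, ?_, ?_, ?_⟩
      · have := hval 0
        rw [h, Nat.mod_eq_of_lt (by change 0 + (m + 1) < _; omega)] at this
        change 0 = 0 + (m + 1) at this
        omega
      · simp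
        omega
      · intro k hk h v
        have := A.inj h
        obtain rfl : k = m + 1 := by omega
        exact hval v
      · simp
      · simp
  | B n =>
    have hn : 3 ≤ n := hX
    obtain ⟨ι, ⟨h1, h2, h3⟩, hval⟩ := exists_isUniqueIota_B hn
    refine ⟨ι, h1, h2, h3, ?_, by simp, by simp, ?_⟩
    · simp only [B.injEq, reduceCtorEq, false_or, or_false]
      constructor
      · intro h
        have h4 := (congrArg Fin.val (h (0 : Fin (n + 1)))).symm.trans (hval (0 : Fin (n + 1)))
        change 0 = swapB n 0 at h4
        have : (n + 1) % 4 ≤ 1 := by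
          by_contra h5
          rw [swapB, if_neg h5] at h4
          simp at h4
        -- `n + 1` is `4 m` or `4 m + 1`, that is, `n` is `4 m - 1` or `4 m`.
        exact ⟨(n + 1) / 4, by omega, by omega⟩
      · rintro ⟨m, hm, h⟩ v
        exact Fin.ext ((hval v).trans (if_pos (by omega)))
    · rintro (⟨m, hm, h⟩ | h)
      · simp only [B.injEq, reduceCtorEq, or_false] at h
        refine ne_refl_iff_B (by omega) h3 fun v => (hval v).trans (if_neg (by omega))
      · simp at h
  | C n =>
    have hn : 2 ≤ n := hX
    obtain ⟨ι, ⟨h1, h2, h3⟩, hval⟩ := exists_isUniqueIota_C hn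
    refine ⟨ι, h1, h2, h3, iff_of_false (fun h => ?_) (by simp), by simp, by simp, fun _ =>
      ne_refl_iff_C hn h3 hval⟩
    have h4 := (congrArg Fin.val (h (0 : Fin (n + 1)))).symm.trans (hval (0 : Fin (n + 1)))
    change 0 = n - 0 at h4
    omega
  | D n =>
    have hn : 4 ≤ n := hX
    obtain ⟨ι, ⟨h1, h2, h3⟩, hval⟩ := exists_isUniqueIota_D hn
    refine ⟨ι, h1, h2, h3, ?_, by simp, fun m hm hD => ?_, by simp⟩
    · simp only [D.injEq, reduceCtorEq, false_or, or_false]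
      constructor
      · intro h
        have h4 := (congrArg Fin.val (h (0 : Fin (n + 1)))).symm.trans (hval (0 : Fin (n + 1)))
        change 0 = swapD n 0 at h4
        have : n % 4 ≤ 1 := by
          by_contra h5
          rw [swapD, if_neg h5] at h4
          simp at h4
        exact ⟨n / 4, by omega, by omega⟩
      · rintro ⟨m, hm, h⟩ v
        exact Fin.ext ((hval v).trans (if_pos (by omega)))
    · simp only [D.injEq] at hD
      refine ⟨fun i j k hi hj hij _ hik hjk => Fin.ext ((hval i).trans
        (swapD_of_common_neighbor (by omega) (by omega) hi hj hij hik hjk)), fun (i : Fin (n + 1)) hi =>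
        Fin.ext ((hval i).trans ?_)⟩
      have h4 := (isExterior_D_iff (n := n) (by omega) i).not.1 hi
      unfold swapD
      split_ifs <;> omega
  | E6 =>
    obtain ⟨h1, h2, h3⟩ := isUniqueIota_E6
    exact ⟨_, h1, h2, h3, by simp, by simp, by simp, by simp⟩
  | E7 =>
    obtain ⟨h1, h2, h3⟩ := isUniqueIota_E7
    have hne : iotaE7 ≠ SimpleGraph.Iso.refl := fun h =>
      (by decide : flipE7 0 ≠ 0) (congrArg (fun τ : E7.graph ≃g E7.graph => τ (0 : Fin 8)) h)
    exact ⟨_, h1, h2, h3, iff_of_false (fun h => hne (RelIso.ext h)) (by simp), by simp, by simp,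
      fun _ τ => ⟨eq_iotaE7, fun h => h ▸ hne⟩⟩
  | E8 =>
    obtain ⟨h1, h2, h3⟩ := isUniqueIota_E8
    exact ⟨_, h1, h2, h3, by simp, by simp, by simp, by simp⟩
  | F4 =>
    obtain ⟨h1, h2, h3⟩ := isUniqueIota_F4
    exact ⟨_, h1, h2, h3, by simp, by simp, by simp, by simp⟩
  | G2 =>
    obtain ⟨h1, h2, h3⟩ := isUniqueIota_G2
    exact ⟨_, h1, h2, h3, by simp, by simp, by simp, by simp⟩
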